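/- Let $\mathbf{OS}$ be the category whose objects are the (complete, abstract) operator spaces over $\mathbb C$, i.e. complex vector spaces $X$ with norms $\|\cdot\|_n$ on the matrix spaces $M_n(X)$, $n\in\mathbb N$, such that $X=M_1(X)$ is a Banach space, $\|x\oplus y\|_{m+n}=\max\{\|x\|_m,\|y\|_n\}$ and $\|\alpha x\beta\|_m\le\|\alpha\|\,\|x\|_m\,\|\beta\|$ for $\alpha,\beta\in M_m(\mathbb C)$, and whose morphisms are the linear complete contractions. An object $S$ of a category is a \emph{strong generator} if (i) for any two distinct parallel morphisms $f,g\colon A\to B$ there is $s\colon S\to A$ with $f\circ s\ne g\circ s$, and (ii) for every monomorphism $m\colon A\to B$ that is not an isomorphism there is a morphism $S\to B$ that does not factor through $m$. Let $T_n$ be the space of $n\times n$ complex matrices with the operator space structure of the dual $M_n^*$ of the C*-algebra $M_n$, via the linear isomorphism $a\mapsto(b\mapsto\sum_{i,j}a_{ij}b_{ij})$; let $\bigoplus^1_n T_n$ be the $\ell^1$ direct sum of these spaces, with the operator space structure it has as a predual of $\bigoplus^\infty_n T_n^*$; and let $T(\ell_2)$ be the Banach space of trace-class operators on $\ell_2$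 with the trace norm, with the operator space structure it has as the predual of $B(\ell_2)$ under the pairing $\langle b,t\rangle=\operatorname{tr}(bt)$. Then: 1. $T(\ell_2)$ is a strong generator for $\mathbf{OS}$; 2. $\bigoplus^1_n T_n$ is a strong generator for $\mathbf{OS}$; 3. there is a complete quotient map $q\colon T(\ell_2)\to\bigoplus^1_n T_n$, i.e. a linear map each of whose amplifications $q_k\colon M_k(T(\ell_2))\to M_k(\bigoplus^1_n T_n)$ maps the open unit ball onto the open unit ball. -/

import Mathlib

universe u v

noncomputable section

namespace OpSp

set_option linter.unusedSectionVars false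

open scoped Matrix.Norms.L2Operator Kronecker ENNReal

/-- The block matrix `x ⊕ y`. -/
def directSum {X : Type*} [Zero X] {m n : ℕ} (x : Matrix (Fin m) (Fin m) X)
    (y : Matrix (Fin n) (Fin n) X) : Matrix (Fin (m + n)) (Fin (m + n)) X :=
  (Matrix.fromBlocks x 0 0 y).submatrix finSumFinEquiv.symm finSumFinEquiv.symm

/-- The product `α x β` of a matrix `x` over `X` with scalar matrices `α`, `β`. -/
def sandwich {X : Type*} [AddCommMonoid X] [Module ℂ X] {n : ℕ}
    (α : Matrix (Fin n) (Fin n) ℂ) (x : Matrix (Fin n) (Fin n) X)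
    (β : Matrix (Fin n) (Fin n) ℂ) : Matrix (Fin n) (Fin n) X :=
  fun i j => ∑ k, ∑ l, (α i k * β l j) • x k l

/-- An operator space structure on a Banach space `X` whose norm is the one given by `M₁(X)`. -/
structure OSS (X : Type*) [NormedAddCommGroup X] [NormedSpace ℂ X] where
  mnorm : ∀ n : ℕ, Matrix (Fin n) (Fin n) X → ℝ
  eq_zero_of_mnorm : ∀ (n : ℕ) (x : Matrix (Fin n) (Fin n) X), mnorm n x = 0 → x = 0
  mnorm_add_le : ∀ (n : ℕ) (x y : Matrix (Fin n) (Fin n) X),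
    mnorm n (x + y) ≤ mnorm n x + mnorm n y
  mnorm_smul : ∀ (n : ℕ) (c : ℂ) (x : Matrix (Fin n) (Fin n) X),
    mnorm n (c • x) = ‖c‖ * mnorm n x
  mnorm_one : ∀ x : X, mnorm 1 (fun _ _ => x) = ‖x‖
  mnorm_directSum : ∀ (m n : ℕ) (x : Matrix (Fin m) (Fin m) X) (y : Matrix (Fin n) (Fin n) X),
    mnorm (m + n) (directSum x y) = max (mnorm m x) (mnorm n y)
  mnorm_sandwich_le : ∀ (n : ℕ) (α : Matrix (Fin n) (Fin n) ℂ) (x : Matrix (Fin n) (Fin n) X)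
    (β : Matrix (Fin n) (Fin n) ℂ), mnorm n (sandwich α x β) ≤ ‖α‖ * mnorm n x * ‖β‖

section basic

variable {X : Type*} [NormedAddCommGroup X] [NormedSpace ℂ X] (S : OSS X)

theorem OSS.mnorm_zero (n : ℕ) : S.mnorm n 0 = 0 := by
  simpa using S.mnorm_smul n 0 0

theorem OSS.mnorm_nonneg {n : ℕ} (x : Matrix (Fin n) (Fin n) X) : 0 ≤ S.mnorm n x := by
  have h := S.mnorm_add_le n x ((-1 : ℂ) • x)
  rw [S.mnorm_smul] at h
  simp [S.mnorm_zero] at h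
  linarith

theorem OSS.mnorm_sum_le {n : ℕ} {ι : Type*} (s : Finset ι)
    (x : ι → Matrix (Fin n) (Fin n) X) : S.mnorm n (∑ i ∈ s, x i) ≤ ∑ i ∈ s, S.mnorm n (x i) := by
  classical
  induction s using Finset.induction_on with
  | empty => simp [S.mnorm_zero]
  | insert a s ha ih =>
    rw [Finset.sum_insert ha, Finset.sum_insert ha]
    exact (S.mnorm_add_le _ _ _).trans (by gcongr)

/-- The matrix with entry `x` in the upper left corner. -/
theorem mnorm_corner (n : ℕ) (x : X) :
    S.mnorm (n + 1) (Matrix.single 0 0 x) = ‖x‖ := by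
  have h := S.mnorm_directSum 1 n (fun _ _ => x) 0
  rw [S.mnorm_one, S.mnorm_zero, max_eq_left (norm_nonneg x)] at h
  rw [← h]
  have key : ∀ (k : ℕ) (e : n + 1 = k) (z : Matrix (Fin k) (Fin k) X),
      (∀ i j : Fin k, z i j = if i.1 = 0 ∧ j.1 = 0 then x else 0) →
      S.mnorm (n + 1) (Matrix.single 0 0 x) = S.mnorm k z := by
    rintro k rfl z hz
    congr 1
    ext i j
    rw [hz, Matrix.single_apply]
    have e1 : ((0 : Fin (n + 1)) = i) = (i.1 = 0) := by
      rw [Fin.ext_iff]; exact propext eq_comm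
    have e2 : ((0 : Fin (n + 1)) = j) = (j.1 = 0) := by
      rw [Fin.ext_iff]; exact propext eq_comm
    simp only [e1, e2]
  refine key _ (by omega) _ fun i j => ?_
  obtain ⟨i, rfl⟩ := finSumFinEquiv.surjective i
  obtain ⟨j, rfl⟩ := finSumFinEquiv.surjective j
  rcases i with i | i <;> rcases j with j | j <;>
    simp [directSum, Matrix.fromBlocks]

theorem sandwich_single {n : ℕ} (a b c d : Fin n) (x : X) :
    sandwich (Matrix.single a b 1) (Matrix.single b c x) (Matrix.single c d 1) =
      Matrix.single a d x := by
  ext i j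
  simp only [sandwich, Matrix.single_apply]
  rw [Finset.sum_eq_single b, Finset.sum_eq_single c]
  · by_cases h1 : a = i <;> by_cases h2 : d = j <;> simp [h1, h2]
  · intro l _ hl; simp [Ne.symm hl]
  · simp
  · intro k _ hk; simp [Ne.symm hk]
  · simp

theorem norm_single_le {n : ℕ} (i j : Fin n) :
    ‖(Matrix.single i j 1 : Matrix (Fin n) (Fin n) ℂ)‖ ≤ 1 := by
  set A : Matrix (Fin n) (Fin n) ℂ := Matrix.single i j 1
  have h : ‖A‖ * ‖A‖ ≤ 1 := by
    rw [← CStarRing.norm_self_mul_star, Matrix.star_eq_conjTranspose]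
    have : A * A.conjTranspose = Matrix.diagonal (Pi.single i 1) := by
      simp [A, Matrix.conjTranspose_single, Matrix.diagonal_single]
    rw [this, Matrix.l2_opNorm_diagonal, Pi.norm_single]
    simp
  nlinarith [norm_nonneg A]

theorem OSS.mnorm_le_sum {n : ℕ} (x : Matrix (Fin n) (Fin n) X) :
    S.mnorm n x ≤ ∑ i, ∑ j, ‖x i j‖ := by
  cases n with
  | zero => rw [Subsingleton.elim x 0, S.mnorm_zero]; simp
  | succ n =>
    conv_lhs => rw [Matrix.matrix_eq_sum_single x]
    refine (S.mnorm_sum_le _ _).trans (Finset.sum_le_sum fun i _ => ?_)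
    refine (S.mnorm_sum_le _ _).trans (Finset.sum_le_sum fun j _ => ?_)
    have h := S.mnorm_sandwich_le (n+1) (Matrix.single i 0 1) (Matrix.single 0 0 (x i j))
      (Matrix.single 0 j 1)
    rw [sandwich_single, mnorm_corner] at h
    refine h.trans ?_
    calc _ ≤ 1 * ‖x i j‖ * 1 := by
          gcongr
          · exact norm_single_le i 0
          · exact norm_single_le 0 j
      _ = _ := by ring

theorem norm_firstRow {n : ℕ} (ξ : Fin (n+1) → ℂ) :
    ‖(Matrix.of fun i k => if i = 0 then star (ξ k) else 0 :
      Matrix (Fin (n+1)) (Fin (n+1)) ℂ)‖ ≤ ‖(WithLp.toLp 2 ξ : EuclideanSpace ℂ (Fin (n+1)))‖ := by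
  set A : Matrix (Fin (n+1)) (Fin (n+1)) ℂ := Matrix.of fun i k => if i = 0 then star (ξ k) else 0
  set r := ‖(WithLp.toLp 2 ξ : EuclideanSpace ℂ (Fin (n+1)))‖
  have h : ‖A‖ * ‖A‖ ≤ r * r := by
    rw [← CStarRing.norm_self_mul_star]
    have : A * star A = Matrix.diagonal fun i => if i = 0 then ((r * r : ℝ) : ℂ) else 0 := by
      ext i j
      rw [Matrix.mul_apply, Matrix.diagonal_apply]
      by_cases hi : i = 0 <;> by_cases hj : j = 0
      · subst hi hj
        simp only [A, Matrix.star_apply, Matrix.of_apply, if_true]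
        have : r * r = ∑ k, ‖ξ k‖ ^ 2 := by
          rw [← sq, EuclideanSpace.norm_sq_eq]
        rw [this]; push_cast
        refine Finset.sum_congr rfl fun k _ => ?_
        simp only [star_star]
        exact Complex.conj_mul' (ξ k)
      all_goals simp [A, hi, hj]
      intro h; exact absurd h.symm hj
    rw [this, Matrix.l2_opNorm_diagonal]
    refine (pi_norm_le_iff_of_nonneg (by positivity)).2 fun i => ?_
    split_ifs
    · rw [Complex.norm_real, Real.norm_of_nonneg (by positivity)]
    · simp; positivity
  nlinarith [norm_nonneg A, norm_nonneg (WithLp.toLp 2 ξ : EuclideanSpace ℂ (Fin (n+1)))]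

theorem OSS.norm_form_le {n : ℕ} (v : Matrix (Fin n) (Fin n) X) (ξ η : Fin n → ℂ) :
    ‖∑ p, ∑ q, (star (ξ p) * η q) • v p q‖ ≤
      ‖(WithLp.toLp 2 ξ : EuclideanSpace ℂ (Fin n))‖ * S.mnorm n v *
        ‖(WithLp.toLp 2 η : EuclideanSpace ℂ (Fin n))‖ := by
  cases n with
  | zero => simpa using mul_nonneg (mul_nonneg (norm_nonneg _) (S.mnorm_nonneg v)) (norm_nonneg _)
  | succ n =>
    set A : Matrix (Fin (n+1)) (Fin (n+1)) ℂ := Matrix.of fun i k => if i = 0 then star (ξ k) else 0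
    set B : Matrix (Fin (n+1)) (Fin (n+1)) ℂ := Matrix.of fun i k => if i = 0 then star (η k) else 0
    have h := S.mnorm_sandwich_le (n+1) A v (star B)
    have h2 : sandwich A v (star B) =
        Matrix.single 0 0 (∑ p, ∑ q, (star (ξ p) * η q) • v p q) := by
      ext i j
      simp only [sandwich, Matrix.single_apply, Matrix.star_apply, A, B, Matrix.of_apply]
      by_cases hi : i = 0 <;> by_cases hj : j = 0
      · simp [hi, hj]
      · simp [hi, hj, Ne.symm hj]
      · simp [hi, hj, Ne.symm hi]
      · simp [hi, hj, Ne.symm hi]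
    rw [h2, mnorm_corner, norm_star] at h
    refine h.trans ?_
    have := S.mnorm_nonneg v
    gcongr
    · exact norm_firstRow ξ
    · exact norm_firstRow η

end basic

/-! ### Auxiliary facts on the operator norm of scalar matrices -/

theorem norm_le_of_form {ι : Type*} [Fintype ι] [DecidableEq ι] (A : Matrix ι ι ℂ) {C : ℝ}
    (hC : 0 ≤ C)
    (h : ∀ ξ η : ι → ℂ, ‖∑ p, ∑ q, (star (ξ p) * η q) * A p q‖ ≤
      ‖(WithLp.toLp 2 ξ : EuclideanSpace ℂ ι)‖ * C * ‖(WithLp.toLp 2 η : EuclideanSpace ℂ ι)‖) :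
    ‖A‖ ≤ C := by
  rw [Matrix.cstar_norm_def]
  refine ContinuousLinearMap.opNorm_le_bound _ hC fun y => ?_
  set z := Matrix.toEuclideanCLM (n := ι) (𝕜 := ℂ) A y with hz
  have h1 := h z.ofLp y.ofLp
  have h2 : ∑ p, ∑ q, (star (z.ofLp p) * y.ofLp q) * A p q = ((‖z‖ * ‖z‖ : ℝ) : ℂ) := by
    have e : ∀ p, z.ofLp p = ∑ q, A p q * y.ofLp q := by
      intro p
      rw [hz, Matrix.ofLp_toEuclideanCLM]; rfl
    have : ‖z‖ * ‖z‖ = ∑ k, ‖z.ofLp k‖ ^ 2 := by rw [← sq, EuclideanSpace.norm_sq_eq]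
    rw [this]; push_cast
    refine Finset.sum_congr rfl fun p _ => ?_
    rw [← Complex.conj_mul' (z.ofLp p)]
    conv_rhs => rw [e p, Finset.mul_sum, ← e p]
    exact Finset.sum_congr rfl fun q _ => by
      rw [starRingEnd_apply]; ring
  rw [h2, Complex.norm_real, Real.norm_of_nonneg (by positivity)] at h1
  simp only [WithLp.toLp_ofLp] at h1
  rcases (norm_nonneg z).eq_or_lt with h0 | h0
  · rw [← h0]; positivity
  · nlinarith

theorem norm_submatrix_equiv {ι κ : Type*} [Fintype ι] [DecidableEq ι] [Fintype κ] [DecidableEq κ]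
    (e : κ ≃ ι) (A : Matrix ι ι ℂ) : ‖A.submatrix e e‖ = ‖A‖ := by
  let f : Matrix ι ι ℂ →⋆ₙₐ[ℂ] Matrix κ κ ℂ :=
    { toFun := fun A => A.submatrix e e
      map_smul' := fun _ _ => rfl
      map_zero' := rfl
      map_add' := fun _ _ => rfl
      map_mul' := fun _ _ => (Matrix.submatrix_mul_equiv _ _ _ e _).symm
      map_star' := fun _ => rfl }
  refine NonUnitalStarAlgHom.norm_map f (fun A B h => ?_) A
  ext i j
  have h1 : A.submatrix e e (e.symm i) (e.symm j) = B.submatrix e e (e.symm i) (e.symm j) :=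
    congrFun (congrFun h (e.symm i)) (e.symm j)
  simpa using h1

theorem norm_fromBlocks_diag {ι κ : Type*} [Fintype ι] [DecidableEq ι] [Fintype κ] [DecidableEq κ]
    (A : Matrix ι ι ℂ) (B : Matrix κ κ ℂ) : ‖Matrix.fromBlocks A 0 0 B‖ = max ‖A‖ ‖B‖ := by
  let f : (Matrix ι ι ℂ × Matrix κ κ ℂ) →⋆ₙₐ[ℂ] Matrix (ι ⊕ κ) (ι ⊕ κ) ℂ :=
    { toFun := fun p => Matrix.fromBlocks p.1 0 0 p.2
      map_smul' := fun c p => by simp [Matrix.fromBlocks_smul]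
      map_zero' := by simp
      map_add' := fun p q => by simp [Matrix.fromBlocks_add]
      map_mul' := fun p q => by simp [Matrix.fromBlocks_multiply]
      map_star' := fun p => by simp [Matrix.star_eq_conjTranspose, Matrix.fromBlocks_conjTranspose] }
  refine NonUnitalStarAlgHom.norm_map f (fun p q h => ?_) (A, B)
  have := Matrix.fromBlocks_inj.1 h
  exact Prod.ext this.1 this.2.2.2

theorem norm_one_kronecker_le {ι κ : Type*} [Fintype ι] [DecidableEq ι] [Fintype κ]
    [DecidableEq κ] (A : Matrix κ κ ℂ) : ‖(1 : Matrix ι ι ℂ) ⊗ₖ A‖ ≤ ‖A‖ := by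
  let f : Matrix κ κ ℂ →⋆ₙₐ[ℂ] Matrix (ι × κ) (ι × κ) ℂ :=
    { toFun := fun A => (1 : Matrix ι ι ℂ) ⊗ₖ A
      map_smul' := fun c A => by simp [Matrix.kronecker_smul]
      map_zero' := by simp
      map_add' := fun p q => by simp [Matrix.kronecker_add]
      map_mul' := fun p q => by simp [← Matrix.mul_kronecker_mul]
      map_star' := fun p => by
        simp [Matrix.star_eq_conjTranspose, Matrix.conjTranspose_kronecker] }
  exact NonUnitalStarAlgHom.norm_apply_le f A

theorem norm_kronecker_one_le {ι κ : Type*} [Fintype ι] [DecidableEq ι] [Fintype κ]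
    [DecidableEq κ] (A : Matrix ι ι ℂ) : ‖A ⊗ₖ (1 : Matrix κ κ ℂ)‖ ≤ ‖A‖ := by
  let f : Matrix ι ι ℂ →⋆ₙₐ[ℂ] Matrix (ι × κ) (ι × κ) ℂ :=
    { toFun := fun A => A ⊗ₖ (1 : Matrix κ κ ℂ)
      map_smul' := fun c A => by simp [Matrix.smul_kronecker]
      map_zero' := by simp
      map_add' := fun p q => by simp [Matrix.add_kronecker]
      map_mul' := fun p q => by simp [← Matrix.mul_kronecker_mul]
      map_star' := fun p => by
        simp [Matrix.star_eq_conjTranspose, Matrix.conjTranspose_kronecker] }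
  exact NonUnitalStarAlgHom.norm_apply_le f A

/-! ### The canonical structure of a C*-algebra -/

section cstar

variable (A : Type*) [CStarAlgebra A]

/-- The norm of the C*-algebra `Mₙ(A)`. (The order on `A` plays no role in its value; Mathlib's
construction of `Mₙ(A)` as a C*-algebra asks for one, and we give it the canonical one.) -/
def cstarNorm (n : ℕ) (x : Matrix (Fin n) (Fin n) A) : ℝ :=
  letI := CStarAlgebra.spectralOrder A
  letI := CStarAlgebra.spectralOrderedRing A
  ‖CStarMatrix.ofMatrix x‖

theorem cstar_add_le {n : ℕ} (x y : Matrix (Fin n) (Fin n) A) :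
    cstarNorm A _ (x + y) ≤ cstarNorm A _ x + cstarNorm A _ y := by
  let _ := CStarAlgebra.spectralOrder A
  have _ := CStarAlgebra.spectralOrderedRing A
  exact norm_add_le (CStarMatrix.ofMatrix x) (CStarMatrix.ofMatrix y)

theorem cstar_smul {n : ℕ} (c : ℂ) (x : Matrix (Fin n) (Fin n) A) :
    cstarNorm A _ (c • x) = ‖c‖ * cstarNorm A _ x := by
  let _ := CStarAlgebra.spectralOrder A
  have _ := CStarAlgebra.spectralOrderedRing A
  exact norm_smul c (CStarMatrix.ofMatrix x)

theorem cstar_eq_zero {n : ℕ} (x : Matrix (Fin n) (Fin n) A) (h : cstarNorm A _ x = 0) :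
    x = 0 := by
  let _ := CStarAlgebra.spectralOrder A
  have _ := CStarAlgebra.spectralOrderedRing A
  exact norm_eq_zero.1 h

theorem cstar_one (x : A) :
    cstarNorm A 1 (fun _ _ => x) = ‖x‖ := by
  let _ := CStarAlgebra.spectralOrder A
  have _ := CStarAlgebra.spectralOrderedRing A
  let f : A →⋆ₙₐ[ℂ] CStarMatrix (Fin 1) (Fin 1) A :=
    { toFun := fun a => CStarMatrix.ofMatrix fun _ _ => a
      map_smul' := fun _ _ => rfl
      map_zero' := rfl
      map_add' := fun _ _ => rfl
      map_mul' := fun a b => by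
        ext i j
        rw [CStarMatrix.mul_apply, Fin.sum_univ_one]; rfl
      map_star' := fun _ => rfl }
  have hf : Function.Injective f := fun a b h => congrFun (congrFun h 0) 0
  exact NonUnitalStarAlgHom.norm_map f hf x

theorem cstar_directSum {m n : ℕ} (x : Matrix (Fin m) (Fin m) A) (y : Matrix (Fin n) (Fin n) A) :
    cstarNorm A _ (directSum x y) =
      max (cstarNorm A _ x) (cstarNorm A _ y) := by
  let _ := CStarAlgebra.spectralOrder A
  have _ := CStarAlgebra.spectralOrderedRing A
  let f : (CStarMatrix (Fin m) (Fin m) A × CStarMatrix (Fin n) (Fin n) A) →⋆ₙₐ[ℂ]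
      CStarMatrix (Fin (m+n)) (Fin (m+n)) A :=
    { toFun := fun p => CStarMatrix.ofMatrix
        (directSum (CStarMatrix.ofMatrix.symm p.1) (CStarMatrix.ofMatrix.symm p.2))
      map_smul' := fun c p => by
        ext i j
        obtain ⟨i, rfl⟩ := finSumFinEquiv.surjective i
        obtain ⟨j, rfl⟩ := finSumFinEquiv.surjective j
        rcases i with i | i <;> rcases j with j | j <;> simp [directSum]
      map_zero' := by
        ext i j
        obtain ⟨i, rfl⟩ := finSumFinEquiv.surjective i
        obtain ⟨j, rfl⟩ := finSumFinEquiv.surjective j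
        rcases i with i | i <;> rcases j with j | j <;> simp [directSum]
      map_add' := fun p q => by
        ext i j
        obtain ⟨i, rfl⟩ := finSumFinEquiv.surjective i
        obtain ⟨j, rfl⟩ := finSumFinEquiv.surjective j
        rcases i with i | i <;> rcases j with j | j <;> simp [directSum]
      map_mul' := fun p q => by
        ext i j
        rw [CStarMatrix.mul_apply, ← finSumFinEquiv.sum_comp]
        obtain ⟨i, rfl⟩ := finSumFinEquiv.surjective i
        obtain ⟨j, rfl⟩ := finSumFinEquiv.surjective j
        rcases i with i | i <;> rcases j with j | j <;> simp [directSum, CStarMatrix.mul_apply]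
      map_star' := fun p => by
        ext i j
        rw [CStarMatrix.star_apply]
        obtain ⟨i, rfl⟩ := finSumFinEquiv.surjective i
        obtain ⟨j, rfl⟩ := finSumFinEquiv.surjective j
        rcases i with i | i <;> rcases j with j | j <;> simp [directSum, CStarMatrix.star_apply] }
  have hf : Function.Injective f := by
    intro p q h
    have h' := fun i j => congrFun (congrFun h (finSumFinEquiv i)) (finSumFinEquiv j)
    refine Prod.ext ?_ ?_
    · ext i j
      simpa [f, directSum] using h' (Sum.inl i) (Sum.inl j)
    · ext i j
      simpa [f, directSum] using h' (Sum.inr i) (Sum.inr j)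
  exact NonUnitalStarAlgHom.norm_map f hf (CStarMatrix.ofMatrix x, CStarMatrix.ofMatrix y)

theorem cstar_sandwich {n : ℕ} (α : Matrix (Fin n) (Fin n) ℂ) (x : Matrix (Fin n) (Fin n) A)
    (β : Matrix (Fin n) (Fin n) ℂ) :
    cstarNorm A _ (sandwich α x β) ≤ ‖α‖ * cstarNorm A _ x * ‖β‖ := by
  let _ := CStarAlgebra.spectralOrder A
  have _ := CStarAlgebra.spectralOrderedRing A
  let f : Matrix (Fin n) (Fin n) ℂ →⋆ₙₐ[ℂ] CStarMatrix (Fin n) (Fin n) A :=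
    { toFun := fun α => CStarMatrix.ofMatrix (α.map (algebraMap ℂ A))
      map_smul' := fun c p => by
        ext i j
        change algebraMap ℂ A (c • p i j) = c • algebraMap ℂ A (p i j)
        simp [Algebra.smul_def]
      map_zero' := by ext i j; simp
      map_add' := fun p q => by ext i j; simp
      map_mul' := fun p q => by
        ext i j; simp [CStarMatrix.mul_apply, Matrix.mul_apply]
      map_star' := fun p => by
        ext i j
        exact algebraMap_star_comm (A := A) (p j i) }
  change ‖_‖ ≤ _ * ‖CStarMatrix.ofMatrix x‖ * _
  have h : CStarMatrix.ofMatrix (sandwich α x β) = f α * CStarMatrix.ofMatrix x * f β := by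
    ext i j
    simp only [CStarMatrix.mul_apply, CStarMatrix.ofMatrix_apply, sandwich, f,
      Finset.sum_mul]
    rw [Finset.sum_comm]
    refine Finset.sum_congr rfl fun k _ => Finset.sum_congr rfl fun l _ => ?_
    change (α i l * β k j) • x l k =
      algebraMap ℂ A (α i l) * x l k * algebraMap ℂ A (β k j)
    rw [mul_assoc, ← Algebra.commutes, ← mul_assoc, ← map_mul, Algebra.smul_def]
  rw [h]
  refine (norm_mul_le _ _).trans ?_
  refine mul_le_mul ((norm_mul_le _ _).trans ?_) (NonUnitalStarAlgHom.norm_apply_le f β)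
    (norm_nonneg _) (by positivity)
  gcongr
  exact NonUnitalStarAlgHom.norm_apply_le f α

/-- The canonical operator space structure of a C*-algebra `A`: `Mₙ(A)` carries its C*-norm. -/
def OSS.cstar : OSS A where
  mnorm := cstarNorm A
  eq_zero_of_mnorm _ := cstar_eq_zero A
  mnorm_add_le _ := cstar_add_le A
  mnorm_smul _ := cstar_smul A
  mnorm_one := cstar_one A
  mnorm_directSum _ _ := cstar_directSum A
  mnorm_sandwich_le _ := cstar_sandwich A

end cstar

/-! ### The dual operator space -/

section dual

variable {V : Type*} [NormedAddCommGroup V] [NormedSpace ℂ V] (S : OSS V)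

/-- For `φ ∈ Mₖ(V*)` and `v ∈ Mₘ(V)`, the matrix `[φ i j (v p q)]` in `Mₘ(Mₖ) = Mₘₖ`: the value at
`v` of the `m`-th amplification of the map `V → Mₖ` given by `φ`. -/
def pairMatrix {k m : ℕ} (φ : Matrix (Fin k) (Fin k) (StrongDual ℂ V))
    (v : Matrix (Fin m) (Fin m) V) : Matrix (Fin m × Fin k) (Fin m × Fin k) ℂ :=
  Matrix.of fun a b => φ a.2 b.2 (v a.1 b.1)

/-- The completely bounded norm of the map `V → Mₖ` given by `φ ∈ Mₖ(V*)`: the supremum of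
`‖φₘ(v)‖` over all `m` and all `v` in the closed unit ball of `Mₘ(V)`. -/
def OSS.dualNorm (k : ℕ) (φ : Matrix (Fin k) (Fin k) (StrongDual ℂ V)) : ℝ :=
  ⨆ v : Σ m : ℕ, {v : Matrix (Fin m) (Fin m) V // S.mnorm m v ≤ 1}, ‖pairMatrix φ v.2.1‖

theorem norm_apply_matrix_le (f : StrongDual ℂ V) {m : ℕ} (v : Matrix (Fin m) (Fin m) V) :
    ‖v.map f‖ ≤ ‖f‖ * S.mnorm m v := by
  have h0 := S.mnorm_nonneg v
  refine norm_le_of_form _ (by positivity) fun ξ η => ?_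
  have : ∑ p, ∑ q, (star (ξ p) * η q) * v.map f p q =
      f (∑ p, ∑ q, (star (ξ p) * η q) • v p q) := by
    simp [map_sum]
  rw [this]
  refine (f.le_opNorm _).trans ?_
  have := mul_le_mul_of_nonneg_left (S.norm_form_le v ξ η) (norm_nonneg f)
  linarith

theorem exists_pairMatrix_bound {k : ℕ} (φ : Matrix (Fin k) (Fin k) (StrongDual ℂ V)) :
    ∃ C : ℝ, 0 ≤ C ∧ ∀ (m : ℕ) (v : Matrix (Fin m) (Fin m) V),
      ‖pairMatrix φ v‖ ≤ C * S.mnorm m v := by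
  refine ⟨∑ i, ∑ j, ‖φ i j‖ * ‖(Matrix.single i j 1 : Matrix (Fin k) (Fin k) ℂ)‖,
    by positivity, fun m v => ?_⟩
  have h : pairMatrix φ v = ∑ i, ∑ j, ((v.map (φ i j)) ⊗ₖ (1 : Matrix (Fin k) (Fin k) ℂ)) *
      ((1 : Matrix (Fin m) (Fin m) ℂ) ⊗ₖ Matrix.single i j 1) := by
    ext ⟨p, i⟩ ⟨q, j⟩
    simp only [← Matrix.mul_kronecker_mul, mul_one, one_mul, Matrix.sum_apply,
      Matrix.kroneckerMap_apply, Matrix.single_apply, pairMatrix, Matrix.of_apply,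
      Matrix.map_apply]
    rw [Finset.sum_eq_single i, Finset.sum_eq_single j]
    · simp
    · intro b _ hb; simp [hb]
    · simp
    · intro b _ hb; simp [hb]
    · simp
  rw [h, Finset.sum_mul]
  refine (norm_sum_le _ _).trans (Finset.sum_le_sum fun i _ => ?_)
  rw [Finset.sum_mul]
  refine (norm_sum_le _ _).trans (Finset.sum_le_sum fun j _ => ?_)
  refine (norm_mul_le _ _).trans ?_
  have h1 := (norm_kronecker_one_le (κ := Fin k) (v.map (φ i j))).trans
    (norm_apply_matrix_le S (φ i j) v)
  have h2 := norm_one_kronecker_le (ι := Fin m) (Matrix.single i j 1 : Matrix (Fin k) (Fin k) ℂ)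
  have := S.mnorm_nonneg v
  calc _ ≤ (‖φ i j‖ * S.mnorm m v) * ‖(Matrix.single i j 1 : Matrix (Fin k) (Fin k) ℂ)‖ := by
        gcongr
    _ = _ := by ring

theorem bddAbove_dualNorm {k : ℕ} (φ : Matrix (Fin k) (Fin k) (StrongDual ℂ V)) :
    BddAbove (Set.range fun v : Σ m : ℕ, {v : Matrix (Fin m) (Fin m) V // S.mnorm m v ≤ 1} =>
      ‖pairMatrix φ v.2.1‖) := by
  obtain ⟨C, hC, h⟩ := exists_pairMatrix_bound S φ
  refine ⟨C, ?_⟩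
  rintro _ ⟨⟨m, v, hv⟩, rfl⟩
  exact (h m v).trans (mul_le_of_le_one_right hC hv)

theorem le_dualNorm {k m : ℕ} (φ : Matrix (Fin k) (Fin k) (StrongDual ℂ V))
    (v : Matrix (Fin m) (Fin m) V) (hv : S.mnorm m v ≤ 1) : ‖pairMatrix φ v‖ ≤ S.dualNorm k φ :=
  le_ciSup (bddAbove_dualNorm S φ) ⟨m, v, hv⟩

theorem dualNorm_nonneg {k : ℕ} (φ : Matrix (Fin k) (Fin k) (StrongDual ℂ V)) :
    0 ≤ S.dualNorm k φ :=
  Real.iSup_nonneg fun _ => norm_nonneg _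

theorem dualNorm_le {k : ℕ} {φ : Matrix (Fin k) (Fin k) (StrongDual ℂ V)} {C : ℝ}
    (h : ∀ (m : ℕ) (v : Matrix (Fin m) (Fin m) V), S.mnorm m v ≤ 1 → ‖pairMatrix φ v‖ ≤ C) :
    S.dualNorm k φ ≤ C :=
  haveI : Nonempty (Σ m : ℕ, {v : Matrix (Fin m) (Fin m) V // S.mnorm m v ≤ 1}) :=
    ⟨⟨0, 0, by rw [S.mnorm_zero]; exact zero_le_one⟩⟩
  ciSup_le fun v => h v.1 v.2.1 v.2.2

theorem dualNorm_add_le (k : ℕ) (φ ψ : Matrix (Fin k) (Fin k) (StrongDual ℂ V)) :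
    S.dualNorm k (φ + ψ) ≤ S.dualNorm k φ + S.dualNorm k ψ := by
  refine dualNorm_le S fun m v hv => ?_
  have : pairMatrix (φ + ψ) v = pairMatrix φ v + pairMatrix ψ v := by
    ext; simp [pairMatrix]
  rw [this]
  exact (norm_add_le _ _).trans (add_le_add (le_dualNorm S φ v hv) (le_dualNorm S ψ v hv))

theorem dualNorm_smul (k : ℕ) (c : ℂ) (φ : Matrix (Fin k) (Fin k) (StrongDual ℂ V)) :
    S.dualNorm k (c • φ) = ‖c‖ * S.dualNorm k φ := by
  unfold OSS.dualNorm
  rw [Real.mul_iSup_of_nonneg (norm_nonneg c)]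
  refine iSup_congr fun v => ?_
  rw [← norm_smul]
  congr 1

theorem dualNorm_one (f : StrongDual ℂ V) : S.dualNorm 1 (fun _ _ => f) = ‖f‖ := by
  refine le_antisymm (dualNorm_le S fun m v hv => ?_) ?_
  · let e : Fin m × Fin 1 ≃ Fin m := Equiv.prodUnique _ _
    have : pairMatrix (fun _ _ => f) v = (v.map f).submatrix e e := rfl
    rw [this, norm_submatrix_equiv]
    exact (norm_apply_matrix_le S f v).trans (mul_le_of_le_one_right (norm_nonneg f) hv)
  · refine ContinuousLinearMap.opNorm_le_of_unit_norm (dualNorm_nonneg S _) fun x hx => ?_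
    have h := le_dualNorm S (fun _ _ => f : Matrix (Fin 1) (Fin 1) (StrongDual ℂ V))
      (fun _ _ => x : Matrix (Fin 1) (Fin 1) V) (by rw [S.mnorm_one, hx])
    refine le_trans ?_ h
    have h2 : pairMatrix (fun _ _ => f : Matrix (Fin 1) (Fin 1) (StrongDual ℂ V))
      (fun _ _ => x : Matrix (Fin 1) (Fin 1) V) = Matrix.diagonal fun _ => f x := by
      ext a b
      rw [Subsingleton.elim a b, Matrix.diagonal_apply_eq]; rfl
    rw [h2, Matrix.l2_opNorm_diagonal]
    exact norm_le_pi_norm (fun _ : Fin 1 × Fin 1 => f x) (0, 0)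

theorem dualNorm_directSum (k l : ℕ) (φ : Matrix (Fin k) (Fin k) (StrongDual ℂ V))
    (ψ : Matrix (Fin l) (Fin l) (StrongDual ℂ V)) :
    S.dualNorm (k + l) (directSum φ ψ) = max (S.dualNorm k φ) (S.dualNorm l ψ) := by
  have key : ∀ (m : ℕ) (v : Matrix (Fin m) (Fin m) V),
      ‖pairMatrix (directSum φ ψ) v‖ = max ‖pairMatrix φ v‖ ‖pairMatrix ψ v‖ := by
    intro m v
    let e : (Fin m × Fin k) ⊕ (Fin m × Fin l) ≃ Fin m × Fin (k + l) :=
      (Equiv.prodSumDistrib _ _ _).symm.trans (Equiv.prodCongrRight fun _ => finSumFinEquiv)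
    rw [← norm_fromBlocks_diag, ← norm_submatrix_equiv e]
    congr 1
    ext a b
    rcases a with ⟨p, i⟩ | ⟨p, i⟩ <;> rcases b with ⟨q, j⟩ | ⟨q, j⟩ <;>
      simp [pairMatrix, directSum, e, Equiv.prodCongrRight]
  refine le_antisymm (dualNorm_le S fun m v hv => ?_) (max_le ?_ ?_)
  · rw [key]
    exact max_le_max (le_dualNorm S φ v hv) (le_dualNorm S ψ v hv)
  · refine dualNorm_le S fun m v hv => le_trans ?_ (le_dualNorm S _ v hv)
    rw [key]; exact le_max_left _ _
  · refine dualNorm_le S fun m v hv => le_trans ?_ (le_dualNorm S _ v hv)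
    rw [key]; exact le_max_right _ _

theorem dualNorm_sandwich_le (k : ℕ) (α : Matrix (Fin k) (Fin k) ℂ)
    (φ : Matrix (Fin k) (Fin k) (StrongDual ℂ V)) (β : Matrix (Fin k) (Fin k) ℂ) :
    S.dualNorm k (sandwich α φ β) ≤ ‖α‖ * S.dualNorm k φ * ‖β‖ := by
  refine dualNorm_le S fun m v hv => ?_
  have h : pairMatrix (sandwich α φ β) v =
      ((1 : Matrix (Fin m) (Fin m) ℂ) ⊗ₖ α) * pairMatrix φ v *
        ((1 : Matrix (Fin m) (Fin m) ℂ) ⊗ₖ β) := by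
    ext ⟨p, i⟩ ⟨q, j⟩
    simp only [Matrix.mul_apply, Fintype.sum_prod_type, Matrix.kroneckerMap_apply,
      Matrix.one_apply, pairMatrix, Matrix.of_apply, sandwich, ite_mul, one_mul, zero_mul,
      mul_ite, mul_zero, Finset.sum_ite_irrel, Finset.sum_const_zero, Finset.sum_ite_eq,
      Finset.sum_ite_eq', Finset.mem_univ, if_true, Finset.sum_mul]
    simp only [_root_.sum_apply, _root_.smul_apply, smul_eq_mul]
    rw [Finset.sum_comm]
    refine Finset.sum_congr rfl fun x _ => Finset.sum_congr rfl fun y _ => ?_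
    ring
  rw [h]
  have h1 := norm_one_kronecker_le (ι := Fin m) α
  have h2 := norm_one_kronecker_le (ι := Fin m) β
  have h3 := le_dualNorm S φ v hv
  have h4 := dualNorm_nonneg S φ
  calc _ ≤ ‖(1 : Matrix (Fin m) (Fin m) ℂ) ⊗ₖ α‖ * ‖pairMatrix φ v‖ *
        ‖(1 : Matrix (Fin m) (Fin m) ℂ) ⊗ₖ β‖ :=
        (norm_mul_le _ _).trans (by gcongr; exact norm_mul_le _ _)
    _ ≤ _ := by gcongr

theorem eq_zero_of_dualNorm (k : ℕ) (φ : Matrix (Fin k) (Fin k) (StrongDual ℂ V))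
    (h : S.dualNorm k φ = 0) : φ = 0 := by
  ext i j x
  simp only [Matrix.zero_apply, _root_.zero_apply]
  by_contra hx
  have hx0 : x ≠ 0 := by rintro rfl; simp at hx
  set y : V := ((‖x‖⁻¹ : ℝ) : ℂ) • x with hy
  have hy1 : ‖y‖ = 1 := by
    rw [hy, norm_smul, Complex.norm_real, norm_inv, norm_norm, inv_mul_cancel₀ (norm_ne_zero_iff.2 hx0)]
  have h1 := le_dualNorm S φ (fun _ _ => y : Matrix (Fin 1) (Fin 1) V) (by rw [S.mnorm_one, hy1])
  rw [h] at h1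
  have h2 := norm_eq_zero.1 (le_antisymm h1 (norm_nonneg _))
  have h3 : φ i j y = 0 := congrFun (congrFun h2 (0, i)) (0, j)
  rw [hy, map_smul, smul_eq_mul, mul_eq_zero] at h3
  rcases h3 with h3 | h3
  · simp [hx0] at h3
  · exact hx h3

/-- The dual operator space `V*`, with `Mₖ(V*) = CB(V, Mₖ)`. -/
def OSS.dual : OSS (StrongDual ℂ V) where
  mnorm := S.dualNorm
  eq_zero_of_mnorm := eq_zero_of_dualNorm S
  mnorm_add_le := dualNorm_add_le S
  mnorm_smul := dualNorm_smul S
  mnorm_one := dualNorm_one S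
  mnorm_directSum := dualNorm_directSum S
  mnorm_sandwich_le := dualNorm_sandwich_le S

end dual

theorem directSum_map {X Y : Type*} [AddCommMonoid X] [AddCommMonoid Y] [Module ℂ X] [Module ℂ Y]
    (f : X →ₗ[ℂ] Y) {m n : ℕ} (x : Matrix (Fin m) (Fin m) X) (y : Matrix (Fin n) (Fin n) X) :
    (directSum x y).map f = directSum (x.map f) (y.map f) := by
  ext i j
  obtain ⟨i, rfl⟩ := finSumFinEquiv.surjective i
  obtain ⟨j, rfl⟩ := finSumFinEquiv.surjective j
  rcases i with i | i <;> rcases j with j | j <;> simp [directSum]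

theorem sandwich_map {X Y : Type*} [AddCommMonoid X] [AddCommMonoid Y] [Module ℂ X] [Module ℂ Y]
    (f : X →ₗ[ℂ] Y) {n : ℕ} (α : Matrix (Fin n) (Fin n) ℂ) (x : Matrix (Fin n) (Fin n) X)
    (β : Matrix (Fin n) (Fin n) ℂ) : (sandwich α x β).map f = sandwich α (x.map f) β := by
  ext i j
  simp [sandwich]

/-- The operator space structure on `X` for which the linear isometry `f : X → V` is a complete
isometry. -/
def OSS.induced {X V : Type*} [NormedAddCommGroup X] [NormedSpace ℂ X] [NormedAddCommGroup V]
    [NormedSpace ℂ V] (S : OSS V) (f : X →ₗᵢ[ℂ] V) : OSS X where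
  mnorm n x := S.mnorm n (x.map f)
  eq_zero_of_mnorm n x h := by
    have := S.eq_zero_of_mnorm n _ h
    ext i j
    exact f.injective ((congrFun (congrFun this i) j).trans (map_zero f).symm)
  mnorm_add_le n x y := by
    rw [Matrix.map_add f (map_add f)]
    exact S.mnorm_add_le _ _ _
  mnorm_smul n c x := by
    rw [← S.mnorm_smul]
    congr 1
    ext i j
    exact f.map_smul c (x i j)
  mnorm_one x := by
    rw [← f.norm_map, ← S.mnorm_one]
    rfl
  mnorm_directSum m n x y := by
    rw [← S.mnorm_directSum]
    exact congrArg _ (directSum_map f.toLinearMap x y)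
  mnorm_sandwich_le n α x β := by
    have : (sandwich α x β).map f = sandwich α (x.map f) β := sandwich_map f.toLinearMap α x β
    rw [this]
    exact S.mnorm_sandwich_le _ _ _ _

/-! ### Direct sums -/

section sums

variable {Λ : Type u} {X : Λ → Type v} [∀ l, NormedAddCommGroup (X l)] [∀ l, NormedSpace ℂ (X l)]
  (S : ∀ l, OSS (X l))

variable (X) in
/-- The coordinate projection `⨁^∞ Xₗ → Xₗ`. -/
def linfCoord (l : Λ) : lp X ∞ →ₗ[ℂ] X l where
  toFun a := a l
  map_add' _ _ := rfl
  map_smul' _ _ := rfl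

/-- The norm of `Mₙ(⨁^∞ Xₗ) = ⨁^∞ Mₙ(Xₗ)`. -/
def linfNorm (n : ℕ) (x : Matrix (Fin n) (Fin n) (lp X ∞)) : ℝ :=
  ⨆ l, (S l).mnorm n (x.map (linfCoord X l))

theorem bddAbove_linf {n : ℕ} (x : Matrix (Fin n) (Fin n) (lp X ∞)) :
    BddAbove (Set.range fun l => (S l).mnorm n (x.map (linfCoord X l))) := by
  refine ⟨∑ i, ∑ j, ‖x i j‖, ?_⟩
  rintro _ ⟨l, rfl⟩
  refine ((S l).mnorm_le_sum _).trans ?_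
  gcongr with i _ j _
  exact lp.norm_apply_le_norm ENNReal.top_ne_zero (x i j) l

theorem le_linfNorm {n : ℕ} (x : Matrix (Fin n) (Fin n) (lp X ∞)) (l : Λ) :
    (S l).mnorm n (x.map (linfCoord X l)) ≤ linfNorm S n x :=
  le_ciSup (bddAbove_linf S x) l

theorem linfNorm_nonneg {n : ℕ} (x : Matrix (Fin n) (Fin n) (lp X ∞)) : 0 ≤ linfNorm S n x :=
  Real.iSup_nonneg fun l => (S l).mnorm_nonneg _

theorem linfNorm_le {n : ℕ} {x : Matrix (Fin n) (Fin n) (lp X ∞)} {C : ℝ} (hC : 0 ≤ C)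
    (h : ∀ l, (S l).mnorm n (x.map (linfCoord X l)) ≤ C) : linfNorm S n x ≤ C :=
  Real.iSup_le h hC

/-- The `ℓ^∞` direct sum of operator spaces. -/
def OSS.linf : OSS (lp X ∞) where
  mnorm := linfNorm S
  eq_zero_of_mnorm n x h := by
    ext i j l
    have h1 : (S l).mnorm n (x.map (linfCoord X l)) = 0 :=
      le_antisymm ((le_linfNorm S x l).trans h.le) ((S l).mnorm_nonneg _)
    exact congrFun (congrFun ((S l).eq_zero_of_mnorm n _ h1) i) j
  mnorm_add_le n x y := by
    refine linfNorm_le S (add_nonneg (linfNorm_nonneg S x) (linfNorm_nonneg S y)) fun l => ?_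
    exact ((S l).mnorm_add_le n _ _).trans (add_le_add (le_linfNorm S x l) (le_linfNorm S y l))
  mnorm_smul n c x := by
    unfold linfNorm
    rw [Real.mul_iSup_of_nonneg (norm_nonneg c)]
    exact iSup_congr fun l => (S l).mnorm_smul n c _
  mnorm_one x := by
    rw [lp.norm_eq_ciSup]
    exact iSup_congr fun l => (S l).mnorm_one (x l)
  mnorm_directSum m n x y := by
    refine le_antisymm (linfNorm_le S (le_max_of_le_left (linfNorm_nonneg S x)) fun l => ?_)
      (max_le ?_ ?_)
    · rw [directSum_map, (S l).mnorm_directSum]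
      exact max_le_max (le_linfNorm S x l) (le_linfNorm S y l)
    · refine linfNorm_le S (linfNorm_nonneg S _) fun l => le_trans ?_ (le_linfNorm S _ l)
      rw [directSum_map, (S l).mnorm_directSum]
      exact le_max_left _ _
    · refine linfNorm_le S (linfNorm_nonneg S _) fun l => le_trans ?_ (le_linfNorm S _ l)
      rw [directSum_map, (S l).mnorm_directSum]
      exact le_max_right _ _
  mnorm_sandwich_le n α x β := by
    have h0 := linfNorm_nonneg S x
    refine linfNorm_le S (by positivity) fun l => ?_
    rw [sandwich_map]
    refine ((S l).mnorm_sandwich_le n _ _ _).trans ?_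
    gcongr
    exact le_linfNorm S x l

variable (X)

theorem hasSum_norm_l1 (X : Λ → Type v) [∀ l, NormedAddCommGroup (X l)] (x : lp X 1) :
    HasSum (fun l => ‖x l‖) ‖x‖ := by
  simpa using lp.hasSum_norm (p := 1) (by simp) x

theorem summable_l1 (x : lp X 1) (φ : lp (fun l => StrongDual ℂ (X l)) ∞) :
    Summable fun l => φ l (x l) :=
  Summable.of_norm_bounded ((hasSum_norm_l1 X x).summable.mul_left ‖φ‖) fun l =>
    ((φ l).le_opNorm _).trans
      (mul_le_mul_of_nonneg_right (lp.norm_apply_le_norm ENNReal.top_ne_zero φ l) (norm_nonneg _))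

theorem norm_tsum_l1_le (x : lp X 1) (φ : lp (fun l => StrongDual ℂ (X l)) ∞) :
    ‖∑' l, φ l (x l)‖ ≤ ‖x‖ * ‖φ‖ := by
  rw [mul_comm]
  exact tsum_of_norm_bounded ((hasSum_norm_l1 X x).mul_left ‖φ‖) fun l =>
    ((φ l).le_opNorm _).trans
      (mul_le_mul_of_nonneg_right (lp.norm_apply_le_norm ENNReal.top_ne_zero φ l) (norm_nonneg _))

/-- The functional `φ ↦ ∑ₗ φₗ(xₗ)` on `⨁^∞ Xₗ*`. -/
def l1Functional (x : lp X 1) : StrongDual ℂ (lp (fun l => StrongDual ℂ (X l)) ∞) :=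
  LinearMap.mkContinuous
    { toFun := fun φ => ∑' l, φ l (x l)
      map_add' := fun φ ψ => by
        rw [← (summable_l1 X x φ).tsum_add (summable_l1 X x ψ)]
        rfl
      map_smul' := fun c φ => by
        rw [RingHom.id_apply, smul_eq_mul, ← tsum_mul_left]
        rfl } ‖x‖ (norm_tsum_l1_le X x)

theorem norm_l1Functional (x : lp X 1) : ‖l1Functional X x‖ = ‖x‖ := by
  refine le_antisymm (LinearMap.mkContinuous_norm_le _ (norm_nonneg x) _) ?_
  choose g hg hgx using fun l => exists_dual_vector'' ℂ (x l)
  let φ : lp (fun l => StrongDual ℂ (X l)) ∞ :=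
    ⟨g, memℓp_infty ⟨1, by rintro _ ⟨l, rfl⟩; exact hg l⟩⟩
  have hφ : ‖φ‖ ≤ 1 := lp.norm_le_of_forall_le zero_le_one hg
  have h1 : l1Functional X x φ = (‖x‖ : ℂ) := by
    change ∑' l, g l (x l) = (‖x‖ : ℂ)
    simp_rw [hgx]
    exact (Complex.hasSum_ofReal.2 (hasSum_norm_l1 X x)).tsum_eq
  have h2 := (l1Functional X x).le_opNorm φ
  rw [h1, Complex.norm_real, norm_norm] at h2
  exact h2.trans (mul_le_of_le_one_right (norm_nonneg _) hφ)

/-- The canonical isometry `⨁¹ Xₗ → (⨁^∞ Xₗ*)*`. -/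
def l1Embed : lp X 1 →ₗᵢ[ℂ] StrongDual ℂ (lp (fun l => StrongDual ℂ (X l)) ∞) where
  toFun := l1Functional X
  map_add' x y := by
    ext φ
    change ∑' l, φ l ((x + y) l) = ∑' l, φ l (x l) + ∑' l, φ l (y l)
    rw [← (summable_l1 X x φ).tsum_add (summable_l1 X y φ)]
    exact tsum_congr fun l => map_add (φ l) _ _
  map_smul' c x := by
    ext φ
    change ∑' l, φ l ((c • x) l) = c • ∑' l, φ l (x l)
    rw [smul_eq_mul, ← tsum_mul_left]
    exact tsum_congr fun l => map_smul (φ l) _ _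
  norm_map' := norm_l1Functional X

variable {X}

/-- The `ℓ¹` direct sum of operator spaces: the structure on the Banach space `⨁¹ Xₗ` coming from
its being a predual of `⨁^∞ Xₗ*`. -/
def OSS.l1 : OSS (lp X 1) :=
  (OSS.linf fun l => (S l).dual).dual.induced (l1Embed X)

end sums

/-! ### The finite-dimensional trace class spaces -/

/-- The underlying space of `Tₙ`: the `n × n` scalar matrices. -/
def TMat (n : ℕ) : Type := Matrix (Fin n) (Fin n) ℂ

instance (n : ℕ) : AddCommGroup (TMat n) :=
  inferInstanceAs (AddCommGroup (Matrix (Fin n) (Fin n) ℂ))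
instance (n : ℕ) : Module ℂ (TMat n) :=
  inferInstanceAs (Module ℂ (Matrix (Fin n) (Fin n) ℂ))

/-- The linear isomorphism of `n × n` matrices with the dual of the C*-algebra `Mₙ`,
`a ↦ (b ↦ ∑ i j, a i j * b i j)`. -/
def TMat.toDual (n : ℕ) : TMat n →ₗ[ℂ] StrongDual ℂ (Matrix (Fin n) (Fin n) ℂ) where
  toFun a := LinearMap.toContinuousLinearMap
    { toFun := fun b => ∑ i, ∑ j, (show Matrix (Fin n) (Fin n) ℂ from a) i j * b i j
      map_add' := fun b c => by simp [mul_add, Finset.sum_add_distrib]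
      map_smul' := fun r b => by simp [Finset.mul_sum, mul_left_comm] }
  map_add' a b := by
    ext c
    change ∑ i, ∑ j, ((show Matrix (Fin n) (Fin n) ℂ from a) i j +
      (show Matrix (Fin n) (Fin n) ℂ from b) i j) * c i j = _
    simp only [add_mul, Finset.sum_add_distrib]
    rfl
  map_smul' r a := by
    ext c
    change ∑ i, ∑ j, (r * (show Matrix (Fin n) (Fin n) ℂ from a) i j) * c i j = r * _
    simp only [mul_assoc, ← Finset.mul_sum]
    rfl

theorem TMat.toDual_bijective (n : ℕ) : Function.Bijective (TMat.toDual n) := by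
  have key : ∀ (a : TMat n) (i j : Fin n), TMat.toDual n a (Matrix.single i j 1) =
      (show Matrix (Fin n) (Fin n) ℂ from a) i j := by
    intro a i j
    change ∑ k, ∑ l, (show Matrix (Fin n) (Fin n) ℂ from a) k l *
      (Matrix.single i j 1 : Matrix (Fin n) (Fin n) ℂ) k l = _
    rw [Finset.sum_eq_single i, Finset.sum_eq_single j]
    · simp
    · intro b _ hb; simp [Ne.symm hb]
    · simp
    · intro b _ hb; simp [Ne.symm hb]
    · simp
  refine ⟨fun a b h => ?_, fun f => ?_⟩
  · refine Matrix.ext (m := Fin n) (n := Fin n) fun i j => ?_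
    exact (key a i j).symm.trans ((DFunLike.congr_fun h (Matrix.single i j 1)).trans (key b i j))
  · refine ⟨(Matrix.of fun i j => f (Matrix.single i j 1) : Matrix (Fin n) (Fin n) ℂ), ?_⟩
    ext b
    change ∑ i, ∑ j, f (Matrix.single i j 1) * b i j = f b
    conv_rhs => rw [Matrix.matrix_eq_sum_single b]
    simp only [map_sum]
    refine Finset.sum_congr rfl fun i _ => Finset.sum_congr rfl fun j _ => ?_
    have : Matrix.single i j (b i j) = b i j • (Matrix.single i j 1 : Matrix (Fin n) (Fin n) ℂ) := by
      simp
    rw [this, map_smul, smul_eq_mul, mul_comm]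

/-- The trace class norm on matrices: the norm of the dual of `Mₙ`. -/
instance (n : ℕ) : NormedAddCommGroup (TMat n) :=
  NormedAddCommGroup.induced _ _ (TMat.toDual n) (TMat.toDual_bijective n).1

instance (n : ℕ) : NormedSpace ℂ (TMat n) :=
  NormedSpace.induced ℂ _ _ (TMat.toDual n)

instance (n : ℕ) : FiniteDimensional ℂ (TMat n) :=
  inferInstanceAs (FiniteDimensional ℂ (Matrix (Fin n) (Fin n) ℂ))

instance (n : ℕ) : CompleteSpace (TMat n) := FiniteDimensional.complete ℂ _

/-- The trace class operator space structure: the one of `Mₙ*`. -/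
def OSS.tMat (n : ℕ) : OSS (TMat n) :=
  (OSS.cstar (Matrix (Fin n) (Fin n) ℂ)).dual.induced
    { toLinearMap := TMat.toDual n
      norm_map' := fun _ => rfl }

/-! ### Trace class operators -/

section traceClass

variable {ι H : Type*} [NormedAddCommGroup H] [InnerProductSpace ℂ H] [CompleteSpace H]

/-- `T` is a trace class operator: `∑ᵢ ⟨eᵢ, |T| eᵢ⟩ < ∞` for the orthonormal basis `e`. -/
def IsTraceClass (e : HilbertBasis ι ℂ H) (T : H →L[ℂ] H) : Prop :=
  Summable fun i => (inner ℂ (e i) (CFC.abs T (e i))).re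

/-- The trace norm `tr |T|`. -/
def traceNorm (e : HilbertBasis ι ℂ H) (T : H →L[ℂ] H) : ℝ :=
  ∑' i, (inner ℂ (e i) (CFC.abs T (e i))).re

/-- The trace of an operator. -/
def opTrace (e : HilbertBasis ι ℂ H) (T : H →L[ℂ] H) : ℂ := ∑' i, inner ℂ (e i) (T (e i))

theorem norm_abs_apply (T : H →L[ℂ] H) (x : H) : ‖CFC.abs T x‖ = ‖T x‖ := by
  have h1 : star (CFC.abs T) = CFC.abs T := (CFC.abs_nonneg T).isSelfAdjoint
  have h2 : star (CFC.abs T) * CFC.abs T = star T * T := by rw [h1, CFC.abs_mul_abs]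
  have key : ∀ S : H →L[ℂ] H, ((‖S x‖ ^ 2 : ℝ) : ℂ) = inner ℂ x ((star S * S) x) := by
    intro S
    rw [mul_apply_eq_comp, ContinuousLinearMap.star_eq_adjoint,
      ContinuousLinearMap.adjoint_inner_right, inner_self_eq_norm_sq_to_K]
    norm_cast
  have h3 : ‖CFC.abs T x‖ ^ 2 = ‖T x‖ ^ 2 := by
    have := (key (CFC.abs T)).trans ((congrArg (fun S : H →L[ℂ] H => inner ℂ x (S x)) h2).trans
      (key T).symm)
    exact_mod_cast this
  exact (sq_eq_sq₀ (norm_nonneg _) (norm_nonneg _)).1 h3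

theorem exists_polar (T : H →L[ℂ] H) : ∃ U : H →L[ℂ] H, ‖U‖ ≤ 1 ∧ U * CFC.abs T = T ∧
    star U * T = CFC.abs T := by
  set P := CFC.abs T with hP
  let K : Submodule ℂ H := (LinearMap.range P.toLinearMap).topologicalClosure
  have hmem : ∀ x, P x ∈ K := fun x =>
    Submodule.le_topologicalClosure _ (LinearMap.mem_range_self P.toLinearMap x)
  have : CompleteSpace K := (Submodule.isClosed_topologicalClosure _).completeSpace_coe
  let p : H →ₗ[ℂ] K := P.toLinearMap.codRestrict K hmem
  have hd : DenseRange p := by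
    intro ⟨y, hy⟩
    rw [Metric.mem_closure_range_iff]
    intro ε hε
    have hy' : y ∈ closure (LinearMap.range P.toLinearMap : Set H) := hy
    obtain ⟨_, ⟨x, rfl⟩, hx⟩ := Metric.mem_closure_iff.1 hy' ε hε
    exact ⟨x, hx⟩
  have hb : ∀ x, ‖T.toLinearMap x‖ ≤ 1 * ‖p x‖ := fun x => by
    rw [one_mul]; exact (norm_abs_apply T x).ge
  let W : K →L[ℂ] H := T.toLinearMap.extendOfNorm p
  have hW : ‖W‖ ≤ 1 := LinearMap.opNorm_extendOfNorm_le hd zero_le_one hb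
  have hWp : ∀ x, W (p x) = T x := LinearMap.extendOfNorm_eq hd ⟨1, hb⟩
  let U : H →L[ℂ] H := W ∘L K.orthogonalProjectionOnto
  have hU : ‖U‖ ≤ 1 := (ContinuousLinearMap.opNorm_comp_le _ _).trans
    (mul_le_one₀ hW (norm_nonneg _) (Submodule.orthogonalProjectionOnto_norm_le K))
  have hUP : ∀ x, U (P x) = T x := by
    intro x
    rw [← hWp]
    change W (K.orthogonalProjectionOnto (p x : H)) = W (p x)
    rw [Submodule.orthogonalProjectionOnto_mem_subspace_eq_self]
  refine ⟨U, hU, ContinuousLinearMap.ext hUP, ContinuousLinearMap.ext fun x => ?_⟩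
  rw [← sub_eq_zero, ← norm_eq_zero, ← sq_eq_zero_iff]
  refine le_antisymm ?_ (sq_nonneg _)
  rw [mul_apply_eq_comp, @norm_sub_sq ℂ, ContinuousLinearMap.star_eq_adjoint,
    ContinuousLinearMap.adjoint_inner_left, hUP, ← ContinuousLinearMap.star_eq_adjoint]
  have h1 : ‖star U (T x)‖ ≤ ‖T x‖ := by
    refine ((star U).le_opNorm _).trans ?_
    rw [norm_star]
    exact mul_le_of_le_one_left (norm_nonneg _) hU
  have h2 : RCLike.re (inner ℂ (T x) (T x)) = ‖T x‖ ^ 2 := inner_self_eq_norm_sq _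
  rw [h2, hP, norm_abs_apply]
  nlinarith [norm_nonneg (star U (T x)), norm_nonneg (T x)]

variable (e : HilbertBasis ι ℂ H)

theorem hasSum_norm_sq (x : H) : HasSum (fun i => ‖inner ℂ (e i) x‖ ^ 2) (‖x‖ ^ 2) := by
  have h := e.hasSum_inner_mul_inner x x
  rw [inner_self_eq_norm_sq_to_K] at h
  have h2 := Complex.hasSum_re h
  convert h2 using 1
  · ext i
    rw [← inner_conj_symm x (e i), Complex.conj_mul']
    norm_cast
  · norm_cast

theorem tsum_hs_adjoint (A : H →L[ℂ] H) :
    ∑' i, ENNReal.ofReal (‖star A (e i)‖ ^ 2) = ∑' i, ENNReal.ofReal (‖A (e i)‖ ^ 2) := by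
  have key : ∀ x : H, ENNReal.ofReal (‖x‖ ^ 2) = ∑' i, ENNReal.ofReal (‖inner ℂ (e i) x‖ ^ 2) := by
    intro x
    rw [← (hasSum_norm_sq e x).tsum_eq,
      ENNReal.ofReal_tsum_of_nonneg (fun _ => by positivity) (hasSum_norm_sq e x).summable]
  simp_rw [key]
  rw [ENNReal.tsum_comm]
  refine tsum_congr fun i => tsum_congr fun j => ?_
  rw [ContinuousLinearMap.star_eq_adjoint, ContinuousLinearMap.adjoint_inner_right,
    norm_inner_symm]

theorem tsum_hs_mul_le (A C : H →L[ℂ] H) (hC : ‖C‖ ≤ 1) :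
    ∑' i, ENNReal.ofReal (‖A (C (e i))‖ ^ 2) ≤ ∑' i, ENNReal.ofReal (‖A (e i)‖ ^ 2) := by
  have h := tsum_hs_adjoint e (A * C)
  rw [← tsum_hs_adjoint e A]
  change _ = ∑' i, ENNReal.ofReal (‖A (C (e i))‖ ^ 2) at h
  rw [← h, star_mul]
  refine ENNReal.tsum_le_tsum fun i => ENNReal.ofReal_le_ofReal ?_
  have : ‖star C (star A (e i))‖ ≤ ‖star A (e i)‖ := by
    refine ((star C).le_opNorm _).trans ?_
    rw [norm_star]
    exact mul_le_of_le_one_left (norm_nonneg _) hC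
  exact pow_le_pow_left₀ (norm_nonneg _) this 2

theorem re_inner_abs (T : H →L[ℂ] H) (x : H) :
    (inner ℂ x (CFC.abs T x)).re = ‖CFC.sqrt (CFC.abs T) x‖ ^ 2 := by
  set R := CFC.sqrt (CFC.abs T) with hR
  have hR1 : star R = R := (CFC.sqrt_nonneg (CFC.abs T)).isSelfAdjoint
  have hR2 : star R * R = CFC.abs T := by
    rw [hR1]; exact CFC.sqrt_mul_sqrt_self (CFC.abs T) (CFC.abs_nonneg T)
  rw [← hR2, mul_apply_eq_comp, ContinuousLinearMap.star_eq_adjoint,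
    ContinuousLinearMap.adjoint_inner_right]
  exact inner_self_eq_norm_sq (𝕜 := ℂ) (R x)

variable {e}

theorem IsTraceClass.hasSum {T : H →L[ℂ] H} (hT : IsTraceClass e T) :
    HasSum (fun i => ‖CFC.sqrt (CFC.abs T) (e i)‖ ^ 2) (traceNorm e T) := by
  simp_rw [← re_inner_abs]
  exact Summable.hasSum hT

theorem IsTraceClass.sum_le {T : H →L[ℂ] H} (hT : IsTraceClass e T) {B : H →L[ℂ] H}
    (hB : ‖B‖ ≤ 1) (F : Finset ι) :
    ∑ i ∈ F, ‖inner ℂ (e i) (B (T (e i)))‖ ≤ traceNorm e T := by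
  obtain ⟨U, hU, hUT, -⟩ := exists_polar T
  set R := CFC.sqrt (CFC.abs T) with hR
  have hR1 : star R = R := (CFC.sqrt_nonneg (CFC.abs T)).isSelfAdjoint
  have hR2 : R * R = CFC.abs T := CFC.sqrt_mul_sqrt_self (CFC.abs T) (CFC.abs_nonneg T)
  set C : H →L[ℂ] H := star (B * U) with hCdef
  have hC : ‖C‖ ≤ 1 := by
    rw [hCdef, norm_star]
    exact (norm_mul_le _ _).trans (mul_le_one₀ hB (norm_nonneg _) hU)
  have h1 : ∀ i, ‖inner ℂ (e i) (B (T (e i)))‖ ≤ (‖R (C (e i))‖ ^ 2 + ‖R (e i)‖ ^ 2) / 2 := by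
    intro i
    have : inner ℂ (e i) (B (T (e i))) = inner ℂ (R (C (e i))) (R (e i)) := by
      have e1 : B (T (e i)) = (B * U) (star R (R (e i))) := by
        rw [hR1]
        conv_lhs => rw [← hUT, ← hR2]
        rfl
      rw [e1, ContinuousLinearMap.star_eq_adjoint, hCdef, ContinuousLinearMap.star_eq_adjoint,
        ← ContinuousLinearMap.adjoint_inner_left, ContinuousLinearMap.adjoint_inner_right]
    rw [this]
    refine (norm_inner_le_norm _ _).trans ?_
    nlinarith [sq_nonneg (‖R (C (e i))‖ - ‖R (e i)‖)]
  have h2 : ∑ i ∈ F, ‖R (C (e i))‖ ^ 2 ≤ traceNorm e T := by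
    have h0 : 0 ≤ traceNorm e T := hT.hasSum.nonneg fun _ => by positivity
    rw [← ENNReal.ofReal_le_ofReal_iff h0, ENNReal.ofReal_sum_of_nonneg (fun _ _ => by positivity)]
    refine (ENNReal.sum_le_tsum F).trans ((tsum_hs_mul_le e R C hC).trans ?_)
    rw [← ENNReal.ofReal_tsum_of_nonneg (fun _ => by positivity) hT.hasSum.summable,
      hT.hasSum.tsum_eq]
  have h3 : ∑ i ∈ F, ‖R (e i)‖ ^ 2 ≤ traceNorm e T :=
    sum_le_hasSum F (fun _ _ => by positivity) hT.hasSum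
  calc _ ≤ ∑ i ∈ F, (‖R (C (e i))‖ ^ 2 + ‖R (e i)‖ ^ 2) / 2 := Finset.sum_le_sum fun i _ => h1 i
    _ = ((∑ i ∈ F, ‖R (C (e i))‖ ^ 2) + ∑ i ∈ F, ‖R (e i)‖ ^ 2) / 2 := by
      rw [← Finset.sum_div, Finset.sum_add_distrib]
    _ ≤ _ := by linarith

theorem IsTraceClass.sum_le' {T : H →L[ℂ] H} (hT : IsTraceClass e T) (B : H →L[ℂ] H)
    (F : Finset ι) :
    ∑ i ∈ F, ‖inner ℂ (e i) (B (T (e i)))‖ ≤ traceNorm e T * ‖B‖ := by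
  rcases eq_or_ne B 0 with rfl | hB
  · simp
  have hB' : ‖B‖ ≠ 0 := norm_ne_zero_iff.2 hB
  set c : ℂ := ((‖B‖⁻¹ : ℝ) : ℂ) with hc
  have hcn : ‖c‖ = ‖B‖⁻¹ := by rw [hc, Complex.norm_real, norm_inv, norm_norm]
  have h := hT.sum_le (B := c • B) (by rw [norm_smul, hcn, inv_mul_cancel₀ hB']) F
  simp only [_root_.smul_apply, inner_smul_right, norm_mul, hcn,
    ← Finset.mul_sum] at h
  rwa [inv_mul_le_iff₀ (by positivity), mul_comm] at h

theorem IsTraceClass.summable {T : H →L[ℂ] H} (hT : IsTraceClass e T) (B : H →L[ℂ] H) :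
    Summable fun i => inner ℂ (e i) (B (T (e i))) :=
  Summable.of_norm (summable_of_sum_le (fun _ => norm_nonneg _) (hT.sum_le' B))

theorem opTrace_add {S T : H →L[ℂ] H} (hS : Summable fun i => inner ℂ (e i) (S (e i)))
    (hT : Summable fun i => inner ℂ (e i) (T (e i))) :
    opTrace e (S + T) = opTrace e S + opTrace e T := by
  rw [opTrace, opTrace, opTrace, ← hS.tsum_add hT]
  exact tsum_congr fun i => inner_add_right _ _ _

theorem opTrace_smul (c : ℂ) (T : H →L[ℂ] H) : opTrace e (c • T) = c * opTrace e T := by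
  rw [opTrace, opTrace, ← tsum_mul_left]
  exact tsum_congr fun i => inner_smul_right _ _ _

theorem norm_opTrace_le {T : H →L[ℂ] H} (hT : IsTraceClass e T) (B : H →L[ℂ] H) :
    ‖opTrace e (B * T)‖ ≤ traceNorm e T * ‖B‖ := by
  have hs := summable_of_sum_le (f := fun i => ‖inner ℂ (e i) (B (T (e i)))‖)
    (fun _ => norm_nonneg _) (hT.sum_le' B)
  exact (norm_tsum_le_tsum_norm hs).trans (hs.tsum_le_of_sum_le (hT.sum_le' B))

theorem isTraceClass_of_summable {T : H →L[ℂ] H}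
    (h : ∀ B : H →L[ℂ] H, Summable fun i => inner ℂ (e i) (B (T (e i)))) : IsTraceClass e T := by
  obtain ⟨U, -, -, hU⟩ := exists_polar T
  have := h (star U)
  simp_rw [← mul_apply_eq_comp, hU] at this
  exact (Complex.hasSum_re this.hasSum).summable

theorem IsTraceClass.add {S T : H →L[ℂ] H} (hS : IsTraceClass e S) (hT : IsTraceClass e T) :
    IsTraceClass e (S + T) :=
  isTraceClass_of_summable fun B => by
    simpa [inner_add_right] using (hS.summable B).add (hT.summable B)

theorem IsTraceClass.smul {T : H →L[ℂ] H} (hT : IsTraceClass e T) (c : ℂ) :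
    IsTraceClass e (c • T) :=
  isTraceClass_of_summable fun B => by
    simpa [inner_smul_right] using (hT.summable B).mul_left c

theorem IsTraceClass.zero : IsTraceClass e (0 : H →L[ℂ] H) :=
  isTraceClass_of_summable fun B => by simp

variable (e) in
/-- The space of trace class operators. -/
def traceClassSubmodule : Submodule ℂ (H →L[ℂ] H) where
  carrier := {T | IsTraceClass e T}
  add_mem' := IsTraceClass.add
  zero_mem' := IsTraceClass.zero
  smul_mem' c _ hT := hT.smul c

variable (e) in
/-- The space of trace class operators, as a type of its own since it does not carry the operator
norm. -/
def TraceClass : Type _ := traceClassSubmodule e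

instance : AddCommGroup (TraceClass e) := inferInstanceAs (AddCommGroup (traceClassSubmodule e))
instance : Module ℂ (TraceClass e) := inferInstanceAs (Module ℂ (traceClassSubmodule e))

variable (e) in
/-- The inclusion of the trace class operators in the bounded operators. -/
def TraceClass.toOp : TraceClass e →ₗ[ℂ] (H →L[ℂ] H) := (traceClassSubmodule e).subtype

theorem TraceClass.isTraceClass (T : TraceClass e) : IsTraceClass e (TraceClass.toOp e T) := T.2

variable (e) in
/-- The functional `B ↦ tr (B T)` on `B(H)`. -/
def TraceClass.functional : TraceClass e →ₗ[ℂ] StrongDual ℂ (H →L[ℂ] H) where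
  toFun T := LinearMap.mkContinuous
    { toFun := fun B => opTrace e (B * TraceClass.toOp e T)
      map_add' := fun B C => by
        rw [add_mul]
        exact opTrace_add (T.isTraceClass.summable B) (T.isTraceClass.summable C)
      map_smul' := fun c B => by
        rw [smul_mul_assoc]
        exact opTrace_smul c _ }
    (traceNorm e (TraceClass.toOp e T)) (norm_opTrace_le T.isTraceClass)
  map_add' S T := by
    ext B
    change opTrace e (B * TraceClass.toOp e (S + T)) = opTrace e (B * TraceClass.toOp e S) +
      opTrace e (B * TraceClass.toOp e T)
    rw [map_add, mul_add]
    exact opTrace_add (S.isTraceClass.summable B) (T.isTraceClass.summable B)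
  map_smul' c T := by
    ext B
    change opTrace e (B * TraceClass.toOp e (c • T)) = c • opTrace e (B * TraceClass.toOp e T)
    rw [map_smul, mul_smul_comm]
    exact opTrace_smul c _

theorem TraceClass.functional_apply (T : TraceClass e) (B : H →L[ℂ] H) :
    TraceClass.functional e T B = opTrace e (B * TraceClass.toOp e T) := rfl

theorem TraceClass.traceNorm_nonneg (T : H →L[ℂ] H) : 0 ≤ traceNorm e T :=
  tsum_nonneg fun i => by rw [re_inner_abs]; positivity

theorem TraceClass.norm_functional (T : TraceClass e) :
    ‖TraceClass.functional e T‖ = traceNorm e (TraceClass.toOp e T) := by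
  refine le_antisymm (ContinuousLinearMap.opNorm_le_bound _ (TraceClass.traceNorm_nonneg _)
    (norm_opTrace_le T.isTraceClass)) ?_
  obtain ⟨U, hU, -, hUT⟩ := exists_polar (TraceClass.toOp e T)
  have h1 : traceNorm e (TraceClass.toOp e T) = (TraceClass.functional e T (star U)).re := by
    rw [TraceClass.functional_apply, opTrace, Complex.re_tsum]
    · rw [hUT]; rfl
    · exact T.isTraceClass.summable (star U)
  rw [h1]
  refine (Complex.re_le_norm _).trans (((TraceClass.functional e T).le_opNorm _).trans ?_)
  rw [norm_star]
  exact mul_le_of_le_one_right (norm_nonneg _) hU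

theorem TraceClass.functional_rankOne (T : TraceClass e) (x y : H) :
    TraceClass.functional e T (InnerProductSpace.rankOne ℂ y x) =
      inner ℂ x (TraceClass.toOp e T y) := by
  rw [TraceClass.functional_apply, opTrace,
    ← ContinuousLinearMap.adjoint_inner_left, ← e.tsum_inner_mul_inner]
  refine tsum_congr fun i => ?_
  rw [mul_apply_eq_comp, InnerProductSpace.rankOne_apply, inner_smul_right,
    ContinuousLinearMap.adjoint_inner_left]

theorem TraceClass.opNorm_le (T : TraceClass e) :
    ‖TraceClass.toOp e T‖ ≤ traceNorm e (TraceClass.toOp e T) := by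
  refine ContinuousLinearMap.opNorm_le_bound _ (TraceClass.traceNorm_nonneg _) fun y => ?_
  set z := TraceClass.toOp e T y with hz
  rcases (norm_nonneg z).eq_or_lt with h0 | h0
  · rw [← h0]; exact mul_nonneg (TraceClass.traceNorm_nonneg _) (norm_nonneg _)
  have h1 := (TraceClass.functional e T).le_opNorm (InnerProductSpace.rankOne ℂ y z)
  rw [TraceClass.functional_rankOne, TraceClass.norm_functional, ← hz,
    InnerProductSpace.norm_rankOne, inner_self_eq_norm_sq_to_K] at h1
  simp only [norm_pow, Complex.coe_algebraMap, Complex.norm_real,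
    norm_norm] at h1
  nlinarith

/-- The Banach space of trace class operators, with the trace norm. -/
instance : NormedAddCommGroup (TraceClass e) :=
  AddGroupNorm.toNormedAddCommGroup
    { toFun := fun T => traceNorm e (TraceClass.toOp e T)
      map_zero' := by rw [← TraceClass.norm_functional, map_zero, norm_zero]
      add_le' := fun S T => by
        rw [← TraceClass.norm_functional, ← TraceClass.norm_functional,
          ← TraceClass.norm_functional, map_add (TraceClass.functional e)]
        exact norm_add_le (TraceClass.functional e S) (TraceClass.functional e T)
      neg' := fun T => by
        rw [← TraceClass.norm_functional, ← TraceClass.norm_functional,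
          map_neg (TraceClass.functional e), norm_neg]
      eq_zero_of_map_eq_zero' := fun T hT => by
        have h := (TraceClass.opNorm_le T).trans hT.le
        exact Subtype.ext (norm_le_zero_iff.1 h) }

theorem TraceClass.norm_def (T : TraceClass e) : ‖T‖ = traceNorm e (TraceClass.toOp e T) := rfl

instance : NormedSpace ℂ (TraceClass e) where
  norm_smul_le c T := by
    rw [TraceClass.norm_def, TraceClass.norm_def, ← TraceClass.norm_functional,
      ← TraceClass.norm_functional, map_smul (TraceClass.functional e), norm_smul]

variable (e) in
/-- The isometric embedding `T ↦ (B ↦ tr (B T))` of the trace class operators in `B(H)*`. -/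
def TraceClass.embed : TraceClass e →ₗᵢ[ℂ] StrongDual ℂ (H →L[ℂ] H) where
  toLinearMap := TraceClass.functional e
  norm_map' T := TraceClass.norm_functional T

instance : CompleteSpace (TraceClass e) := by
  refine Metric.complete_of_cauchySeq_tendsto fun u hu => ?_
  have hle : ∀ S T : TraceClass e,
      ‖TraceClass.toOp e S - TraceClass.toOp e T‖ ≤ ‖S - T‖ := fun S T => by
    rw [← map_sub]; exact TraceClass.opNorm_le _
  have hu' : CauchySeq fun n => TraceClass.toOp e (u n) := by
    rw [Metric.cauchySeq_iff'] at hu ⊢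
    intro ε hε
    obtain ⟨N, hN⟩ := hu ε hε
    refine ⟨N, fun n hn => lt_of_le_of_lt ?_ (hN n hn)⟩
    rw [dist_eq_norm, dist_eq_norm]
    exact hle _ _
  obtain ⟨T, hT⟩ := cauchySeq_tendsto_of_complete hu'
  -- finite sums pass to the limit
  have hlim : ∀ (A B : H →L[ℂ] H) (F : Finset ι), Filter.Tendsto
      (fun n => ∑ i ∈ F, ‖inner ℂ (e i) (B ((TraceClass.toOp e (u n) - A) (e i)))‖) Filter.atTop
      (nhds (∑ i ∈ F, ‖inner ℂ (e i) (B ((T - A) (e i)))‖)) := by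
    intro A B F
    refine tendsto_finsetSum F fun i _ => ?_
    have h1 : Continuous fun S : H →L[ℂ] H => ‖inner ℂ (e i) (B ((S - A) (e i)))‖ := by fun_prop
    exact (h1.tendsto T).comp hT
  have hbound : ∀ (N : ℕ) (ε : ℝ), (∀ n ≥ N, ‖u n - u N‖ ≤ ε) → ∀ (B : H →L[ℂ] H) (F : Finset ι),
      ∑ i ∈ F, ‖inner ℂ (e i) (B ((T - TraceClass.toOp e (u N)) (e i)))‖ ≤ ε * ‖B‖ := by
    intro N ε hN B F
    refine le_of_tendsto (hlim _ B F) (Filter.eventually_atTop.2 ⟨N, fun n hn => ?_⟩)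
    rw [← map_sub]
    refine ((u n - u N).isTraceClass.sum_le' B F).trans ?_
    exact mul_le_mul_of_nonneg_right (hN n hn) (norm_nonneg B)
  have htc : ∀ (N : ℕ) (ε : ℝ), (∀ n ≥ N, ‖u n - u N‖ ≤ ε) →
      IsTraceClass e (T - TraceClass.toOp e (u N)) := fun N ε hN =>
    isTraceClass_of_summable fun B =>
      Summable.of_norm (summable_of_sum_le (fun _ => norm_nonneg _) (hbound N ε hN B))
  rw [Metric.cauchySeq_iff'] at hu
  have hu2 : ∀ ε > 0, ∃ N, ∀ n ≥ N, ‖u n - u N‖ ≤ ε := fun ε hε => by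
    obtain ⟨N, hN⟩ := hu ε hε
    exact ⟨N, fun n hn => by rw [← dist_eq_norm]; exact (hN n hn).le⟩
  obtain ⟨N₀, hN₀⟩ := hu2 1 one_pos
  have hTc : IsTraceClass e T := by
    have := (htc N₀ 1 hN₀).add (u N₀).isTraceClass
    rwa [sub_add_cancel] at this
  obtain ⟨T', hT'⟩ : ∃ T' : TraceClass e, TraceClass.toOp e T' = T := ⟨⟨T, hTc⟩, rfl⟩
  refine ⟨T', ?_⟩
  rw [Metric.tendsto_atTop]
  intro ε hε
  obtain ⟨N, hN⟩ := hu2 (ε / 3) (by positivity)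
  have hkey : ‖T' - u N‖ ≤ ε / 3 := by
    rw [TraceClass.norm_def, ← TraceClass.norm_functional]
    refine ContinuousLinearMap.opNorm_le_bound _ (by positivity) fun B => ?_
    rw [TraceClass.functional_apply, map_sub, hT']
    have hs := summable_of_sum_le
      (f := fun i => ‖inner ℂ (e i) (B ((T - TraceClass.toOp e (u N)) (e i)))‖)
      (fun _ => norm_nonneg _) (hbound N _ hN B)
    exact (norm_tsum_le_tsum_norm hs).trans (hs.tsum_le_of_sum_le (hbound N _ hN B))
  refine ⟨N, fun n hn => ?_⟩
  rw [dist_eq_norm]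
  have h1 := hN n hn
  have h2 := norm_sub_le_norm_sub_add_norm_sub (u n) (u N)
    T'
  rw [norm_sub_rev (u N)] at h2
  linarith

end traceClass

/-- The operator space structure of `T(H)`: the one of the predual of `B(H)`, for the pairing
`⟨B, T⟩ = tr (B T)`. -/
def OSS.traceClass {ι H : Type*} [NormedAddCommGroup H] [InnerProductSpace ℂ H] [CompleteSpace H]
    (e : HilbertBasis ι ℂ H) : OSS (TraceClass e) :=
  (OSS.cstar (H →L[ℂ] H)).dual.induced (TraceClass.embed e)

/-! ### The category of operator spaces -/

/-- An operator space: a complex Banach space with an operator space structure. -/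
structure OS : Type (u + 1) where
  carrier : Type u
  [normedAddCommGroup : NormedAddCommGroup carrier]
  [normedSpace : NormedSpace ℂ carrier]
  [completeSpace : CompleteSpace carrier]
  oss : OSS carrier

attribute [instance] OS.normedAddCommGroup OS.normedSpace OS.completeSpace

/-- A linear complete contraction. -/
@[ext]
structure OS.Hom (X : OS.{u}) (Y : OS.{v}) where
  toLinearMap : X.carrier →ₗ[ℂ] Y.carrier
  mnorm_map_le : ∀ (n : ℕ) (x : Matrix (Fin n) (Fin n) X.carrier),
    Y.oss.mnorm n (x.map toLinearMap) ≤ X.oss.mnorm n x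

/-- The category of operator spaces and linear complete contractions. -/
instance : CategoryTheory.Category OS.{u} where
  Hom X Y := OS.Hom X Y
  id X := ⟨LinearMap.id, fun _ _ => le_rfl⟩
  comp f g := ⟨g.toLinearMap ∘ₗ f.toLinearMap, fun n x =>
    (g.mnorm_map_le n (x.map f.toLinearMap)).trans (f.mnorm_map_le n x)⟩

/-- A complete quotient map: every amplification maps the open unit ball onto the open unit
ball. -/
def OS.IsCompleteQuotient {X : OS.{u}} {Y : OS.{v}}
    (f : X.carrier →ₗ[ℂ] Y.carrier) : Prop :=
  ∀ n : ℕ, (fun x : Matrix (Fin n) (Fin n) X.carrier => x.map f) '' {x | X.oss.mnorm n x < 1} =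
    {y | Y.oss.mnorm n y < 1}

/-- The operator space `Tₙ`. -/
def OS.T (n : ℕ) : OS.{0} where
  carrier := TMat n
  oss := OSS.tMat n

/-- The `ℓ¹` direct sum of a family of operator spaces. -/
def OS.l1Sum {Λ : Type u} (X : Λ → OS.{v}) : OS.{max u v} where
  carrier := lp (fun l => (X l).carrier) 1
  oss := OSS.l1 fun l => (X l).oss

/-- The standard orthonormal basis of `ℓ₂(ℕ)`; `ULift` only places `ℓ₂` in the universe `u`. -/
def l2Basis : HilbertBasis (ULift.{u} ℕ) ℂ (lp (fun _ : ULift.{u} ℕ => ℂ) 2) :=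
  HilbertBasis.ofRepr (LinearIsometryEquiv.refl ℂ _)

/-- The operator space `T(ℓ₂)` of trace class operators on `ℓ₂`. -/
def OS.traceClassL2 : OS.{u} where
  carrier := TraceClass l2Basis.{u}
  oss := OSS.traceClass l2Basis.{u}

/-- The operator space `⨁¹ₙ Tₙ`, with `n` ranging over `ℕ`. -/
def OS.l1SumT : OS.{u} := OS.l1Sum fun n : ULift.{u} ℕ => OS.T n.down

end OpSp

end

/-!
The argument rests on the fact that the unit ball of `Mₙ(Y)`, for an operator space `Y`, is the set
of complete contractions `Tₙ → Y`, via `y ↦ (a ↦ ∑ a i j • y i j)` (`TMat.mnorm_map_lift_le` and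
`TMat.mnorm_universal_le`). Hence an operator space `G` of which every `Tₙ` is a completely
contractive retract is a strong generator (`OS.HasRetractsT.isStrongGenerator`): the unit ball of
`Y = M₁(Y)` separates morphisms, and if all morphisms `G → Y` factor through a monomorphism
`X → Y`, then so do all morphisms `Tₙ → Y`, so that the unit ball of every `Mₙ(X)` is mapped onto
that of `Mₙ(Y)`.

That the map `Tₙ → Y` given by a `y` in the unit ball is completely contractive holds by definition
of `Tₙ = Mₙ*` if `Y` is a matrix algebra. The general case follows because the norm of a
`z ∈ Mₘ(Y)` is approximated by the norms of `φₘ(z)` for complete contractions `φ : Y → Mₘ`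
(`OSS.exists_norming_matrix`, a lemma of Ruan). To obtain `φ`, one takes a functional `F` on
`Mₘ(Y)` that norms `z`. The elements `(ααᴴ, ββᴴ, 2 Re F(αxβᴴ))`, with `x` in a unit ball, form a
convex cone, thanks to `‖x ⊕ y‖ = max ‖x‖ ‖y‖`. Its Hahn–Banach separation from the open cone
`‖A‖ + ‖B‖ < Re t` yields two positive functionals of mass at most one that dominate `F`
(`exists_positive_bound`), and their densities, made invertible by a small perturbation, turn `F`
into `φ`.

Each `Tₙ` is a retract of `⨁¹ Tₙ` as one of its summands. Finally `⨁¹ Tₙ` is a retract of `T(ℓ₂)`: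
for orthonormal blocks of all sizes, the block diagonal embedding `⨁¹ Tₙ → T(ℓ₂)` is dual to the
compression of operators to their diagonal blocks (`mnorm_map_blocksIncl_le`), and the map
`T(ℓ₂) → ⨁¹ Tₙ` that takes diagonal blocks is dual to the isometric embedding of block diagonal
matrices in `B(ℓ₂)` (`mnorm_map_traceBlocks_le`). The second is a left inverse of the first, hence a
complete quotient map.
-/

noncomputable section

namespace OpSp

open scoped Matrix.Norms.L2Operator Kronecker ENNReal

/-! ### Rectangular compressions of matrices over an operator space -/

section rect

variable {X : Type*} [NormedAddCommGroup X] [NormedSpace ℂ X]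

/-- The product `α x β` of a square matrix `x` over `X` with rectangular scalar matrices. -/
def rectSandwich {m r : ℕ} (α : Matrix (Fin m) (Fin r) ℂ) (x : Matrix (Fin r) (Fin r) X)
    (β : Matrix (Fin r) (Fin m) ℂ) : Matrix (Fin m) (Fin m) X :=
  fun i j => ∑ k, ∑ l, (α i k * β l j) • x k l

section directSum_apply

variable {Y : Type*} [Zero Y] {m r : ℕ} (x : Matrix (Fin m) (Fin m) Y)
  (y : Matrix (Fin r) (Fin r) Y)

@[simp] theorem directSum_castAdd_castAdd (i j : Fin m) :
    directSum x y (Fin.castAdd r i) (Fin.castAdd r j) = x i j := by simp [directSum]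

@[simp] theorem directSum_castAdd_natAdd (i : Fin m) (j : Fin r) :
    directSum x y (Fin.castAdd r i) (Fin.natAdd m j) = 0 := by simp [directSum]

@[simp] theorem directSum_natAdd_castAdd (i : Fin r) (j : Fin m) :
    directSum x y (Fin.natAdd m i) (Fin.castAdd r j) = 0 := by simp [directSum]

@[simp] theorem directSum_natAdd_natAdd (i j : Fin r) :
    directSum x y (Fin.natAdd m i) (Fin.natAdd m j) = y i j := by simp [directSum]

end directSum_apply

theorem l2_opNorm_mul_conjTranspose_self {ι κ : Type*} [Fintype ι] [DecidableEq ι] [Fintype κ]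
    [DecidableEq κ] (A : Matrix ι κ ℂ) : ‖A * A.conjTranspose‖ = ‖A‖ * ‖A‖ := by
  have h := Matrix.l2_opNorm_conjTranspose_mul_self A.conjTranspose
  rwa [Matrix.conjTranspose_conjTranspose, Matrix.l2_opNorm_conjTranspose] at h

theorem norm_one_le {ι : Type*} [Fintype ι] [DecidableEq ι] : ‖(1 : Matrix ι ι ℂ)‖ ≤ 1 := by
  rw [← Matrix.diagonal_one, Matrix.l2_opNorm_diagonal]
  exact (pi_norm_le_iff_of_nonneg zero_le_one).2 fun i => by simp

theorem norm_fromBlocks_upperRight {ι κ : Type*} [Fintype ι] [DecidableEq ι] [Fintype κ]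
    [DecidableEq κ] (A : Matrix ι κ ℂ) :
    ‖(Matrix.fromBlocks 0 A 0 0 : Matrix (ι ⊕ κ) (ι ⊕ κ) ℂ)‖ = ‖A‖ := by
  have h := l2_opNorm_mul_conjTranspose_self
    (Matrix.fromBlocks 0 A 0 0 : Matrix (ι ⊕ κ) (ι ⊕ κ) ℂ)
  rw [Matrix.fromBlocks_conjTranspose, Matrix.fromBlocks_multiply] at h
  simp only [Matrix.conjTranspose_zero, mul_zero, Matrix.mul_zero, Matrix.zero_mul,
    add_zero, zero_add] at h
  rw [norm_fromBlocks_diag, norm_zero, max_eq_left (norm_nonneg _),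
    l2_opNorm_mul_conjTranspose_self] at h
  exact ((mul_self_inj (norm_nonneg _) (norm_nonneg _)).1 h).symm

theorem norm_fromBlocks_lowerLeft {ι κ : Type*} [Fintype ι] [DecidableEq ι] [Fintype κ]
    [DecidableEq κ] (A : Matrix κ ι ℂ) :
    ‖(Matrix.fromBlocks 0 0 A 0 : Matrix (ι ⊕ κ) (ι ⊕ κ) ℂ)‖ = ‖A‖ := by
  rw [← Matrix.l2_opNorm_conjTranspose, Matrix.fromBlocks_conjTranspose]
  simp only [Matrix.conjTranspose_zero]
  rw [norm_fromBlocks_upperRight, Matrix.l2_opNorm_conjTranspose]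

/-- The rectangular form of the second axiom of an operator space, by padding all matrices with
zeros to square ones of size `m + r`. -/
theorem OSS.mnorm_rectSandwich_le (S : OSS X) {m r : ℕ} (α : Matrix (Fin m) (Fin r) ℂ)
    (x : Matrix (Fin r) (Fin r) X) (β : Matrix (Fin r) (Fin m) ℂ) :
    S.mnorm m (rectSandwich α x β) ≤ ‖α‖ * S.mnorm r x * ‖β‖ := by
  set α' : Matrix (Fin (m + r)) (Fin (m + r)) ℂ :=
    (Matrix.fromBlocks 0 α 0 0).submatrix finSumFinEquiv.symm finSumFinEquiv.symm with hα
  set β' : Matrix (Fin (m + r)) (Fin (m + r)) ℂ :=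
    (Matrix.fromBlocks 0 0 β 0).submatrix finSumFinEquiv.symm finSumFinEquiv.symm with hβ
  have h := S.mnorm_sandwich_le (m + r) α' (directSum (0 : Matrix (Fin m) (Fin m) X) x) β'
  have e : sandwich α' (directSum (0 : Matrix (Fin m) (Fin m) X) x) β' =
      directSum (rectSandwich α x β) (0 : Matrix (Fin r) (Fin r) X) := by
    ext i j
    induction i using Fin.addCases <;> induction j using Fin.addCases <;>
      simp [sandwich, rectSandwich, Fin.sum_univ_add, hα, hβ]
  rw [e, S.mnorm_directSum, S.mnorm_directSum, S.mnorm_zero, S.mnorm_zero,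
    max_eq_left (S.mnorm_nonneg _), max_eq_right (S.mnorm_nonneg _), hα, hβ,
    norm_submatrix_equiv, norm_submatrix_equiv, norm_fromBlocks_upperRight,
    norm_fromBlocks_lowerLeft] at h
  exact h

/-- The norm of `Mₘ(X)`, as a seminorm. -/
def OSS.seminorm (S : OSS X) (m : ℕ) : Seminorm ℂ (Matrix (Fin m) (Fin m) X) :=
  Seminorm.of (S.mnorm m) (S.mnorm_add_le m) (S.mnorm_smul m)

theorem exists_norming_functional {E : Type*} [AddCommGroup E] [Module ℂ E] (p : Seminorm ℂ E)
    (z : E) : ∃ F : E →ₗ[ℂ] ℂ, (∀ x, ‖F x‖ ≤ p x) ∧ F z = p z := by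
  let c : SeminormedAddCommGroup E := p.toAddGroupSeminorm.toSeminormedAddCommGroup
  let s : NormedSpace ℂ E := ⟨fun c x => (map_smul_eq_mul p c x).le⟩
  have h := exists_dual_vector'' ℂ z
  exact h.elim fun g hg => ⟨g.toLinearMap, fun x =>
    (g.le_opNorm x).trans (mul_le_of_le_one_left (norm_nonneg _) hg.1), hg.2⟩

/-- A functional on `Mₘ(X)` that attains the norm of `z`. -/
theorem OSS.exists_norming (S : OSS X) {m : ℕ} (z : Matrix (Fin m) (Fin m) X) :
    ∃ F : Matrix (Fin m) (Fin m) X →ₗ[ℂ] ℂ,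
      (∀ x, ‖F x‖ ≤ S.mnorm m x) ∧ F z = S.mnorm m z :=
  exists_norming_functional (S.seminorm m) z

end rect

/-! ### Density matrices -/

section density

open Matrix
open scoped ComplexOrder

theorem sum_norm_sq_eq_re_trace {ι κ : Type*} [Fintype ι] [Fintype κ] (A : Matrix ι κ ℂ) :
    ∑ i, ∑ j, ‖A i j‖ ^ 2 = (Aᴴ * A).trace.re := by
  simp only [Matrix.trace, Matrix.diag, Matrix.mul_apply, Matrix.conjTranspose_apply,
    Complex.re_sum]
  rw [Finset.sum_comm]
  refine Finset.sum_congr rfl fun j _ => Finset.sum_congr rfl fun i _ => ?_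
  rw [← starRingEnd_apply, Complex.conj_mul']
  norm_cast

/-- `g(ααᴴ) = tr(αᴴ G α)` for the matrix `G` that represents the functional `g`. -/
theorem apply_mul_conjTranspose_eq_trace {m : ℕ} (g : Matrix (Fin m) (Fin m) ℂ →ₗ[ℂ] ℂ)
    {ι : Type*} [Fintype ι] (α : Matrix (Fin m) ι ℂ) :
    g (α * αᴴ) = (αᴴ * (Matrix.of fun i j => g (Matrix.single j i 1)) * α).trace := by
  have h : ∀ A : Matrix (Fin m) (Fin m) ℂ,
      g A = ((Matrix.of fun i j => g (Matrix.single j i 1)) * A).trace := by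
    intro A
    conv_lhs => rw [Matrix.matrix_eq_sum_single A]
    simp only [map_sum, Matrix.trace, Matrix.diag, Matrix.mul_apply, Matrix.of_apply]
    rw [Finset.sum_comm]
    refine Finset.sum_congr rfl fun i _ => Finset.sum_congr rfl fun j _ => ?_
    have : Matrix.single j i (A j i) = A j i • (Matrix.single j i 1 : Matrix (Fin m) (Fin m) ℂ) := by
      simp
    rw [this, map_smul, smul_eq_mul, mul_comm]
  rw [h, ← Matrix.mul_assoc, Matrix.trace_mul_comm, ← Matrix.mul_assoc]

/-- A functional that is positive (in real part) on `Mₘ` is dominated by the faithful positive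
functional of an invertible density `RᴴR`, whose mass exceeds that of the functional by as little
as desired. -/
theorem exists_density {m : ℕ} (g : Matrix (Fin m) (Fin m) ℂ →ₗ[ℂ] ℂ)
    (hg : ∀ (r : ℕ) (α : Matrix (Fin m) (Fin r) ℂ), 0 ≤ (g (α * αᴴ)).re) {ε : ℝ} (hε : 0 < ε) :
    ∃ R : Matrix (Fin m) (Fin m) ℂ, IsUnit R ∧
      (∀ (r : ℕ) (α : Matrix (Fin m) (Fin r) ℂ),
        (g (α * αᴴ)).re ≤ ∑ i, ∑ j, ‖(R * α) i j‖ ^ 2) ∧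
      ∑ i, ∑ j, ‖R i j‖ ^ 2 = (g 1).re + m * ε := by
  set G : Matrix (Fin m) (Fin m) ℂ := Matrix.of fun i j => g (Matrix.single j i 1) with hG
  -- the Hermitian part of the matrix that represents `g`
  set K : Matrix (Fin m) (Fin m) ℂ := (1 / 2 : ℂ) • (G + Gᴴ) with hK
  have hre : ∀ {ι : Type} [Fintype ι] (α : Matrix (Fin m) ι ℂ),
      (αᴴ * K * α).trace = ((g (α * αᴴ)).re : ℂ) := by
    intro ι _ α
    have h2 : (αᴴ * Gᴴ * α).trace = star (αᴴ * G * α).trace := by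
      rw [← Matrix.trace_conjTranspose]
      simp [Matrix.conjTranspose_mul, Matrix.mul_assoc]
    rw [apply_mul_conjTranspose_eq_trace, hK, Matrix.mul_smul, Matrix.smul_mul, Matrix.mul_add,
      Matrix.add_mul, Matrix.trace_smul, Matrix.trace_add, h2, Complex.re_eq_add_conj,
      smul_eq_mul, starRingEnd_apply]
    ring
  have hKs : K.PosSemidef := by
    refine Matrix.PosSemidef.of_dotProduct_mulVec_nonneg ?_ fun x => ?_
    · simp [Matrix.IsHermitian, hK, add_comm]
    · have h1 := hre (Matrix.replicateCol (Fin 1) x)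
      have h2 : ((Matrix.replicateCol (Fin 1) x)ᴴ * K * Matrix.replicateCol (Fin 1) x).trace =
          star x ⬝ᵥ K *ᵥ x := by
        rw [Matrix.mul_assoc]
        simp [Matrix.trace, Matrix.mul_apply, dotProduct, Matrix.mulVec]
      rw [← h2, h1]
      exact_mod_cast hg 1 _
  have hP : (((ε : ℂ) • (1 : Matrix (Fin m) (Fin m) ℂ)) + K).PosDef :=
    (Matrix.PosDef.one.smul (by exact_mod_cast hε)).add_posSemidef hKs
  obtain ⟨R, hR, hRP⟩ : ∃ R : Matrix (Fin m) (Fin m) ℂ, IsUnit R ∧ ((ε : ℂ) • 1) + K = Rᴴ * R :=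
    by
    open scoped MatrixOrder in
    exact CStarAlgebra.isStrictlyPositive_iff_eq_star_mul_self.1 hP.isStrictlyPositive
  refine ⟨R, hR, fun r α => ?_, ?_⟩
  · have e : (R * α)ᴴ * (R * α) = (ε : ℂ) • (αᴴ * α) + αᴴ * K * α := by
      rw [Matrix.conjTranspose_mul, Matrix.mul_assoc, ← Matrix.mul_assoc Rᴴ, ← hRP]
      simp [Matrix.add_mul, Matrix.mul_add, Matrix.mul_assoc]
    rw [sum_norm_sq_eq_re_trace, e, Matrix.trace_add, hre, Matrix.trace_smul, Complex.add_re,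
      Complex.ofReal_re, smul_eq_mul, Complex.re_ofReal_mul, ← sum_norm_sq_eq_re_trace]
    have : 0 ≤ ε * ∑ i, ∑ j, ‖α i j‖ ^ 2 := by positivity
    linarith
  · have h1 := hre (1 : Matrix (Fin m) (Fin m) ℂ)
    simp only [Matrix.conjTranspose_one, Matrix.one_mul, Matrix.mul_one] at h1
    rw [sum_norm_sq_eq_re_trace, ← hRP, Matrix.trace_add, h1, Matrix.trace_smul, Matrix.trace_one,
      Complex.add_re, Complex.ofReal_re, smul_eq_mul, Complex.re_ofReal_mul]
    simp
    ring

end density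

/-! ### Domination of functionals on `Mₘ(X)` -/

section positiveBound

open Matrix

variable {X : Type*} [NormedAddCommGroup X] [NormedSpace ℂ X]

theorem norm_form_le_opNorm {ι : Type*} [Fintype ι] [DecidableEq ι] (A : Matrix ι ι ℂ)
    (ξ η : ι → ℂ) :
    ‖∑ p, ∑ q, (star (ξ p) * η q) * A p q‖ ≤
      ‖(WithLp.toLp 2 ξ : EuclideanSpace ℂ ι)‖ * ‖A‖ * ‖(WithLp.toLp 2 η : EuclideanSpace ℂ ι)‖ := by
  have h : ∑ p, ∑ q, (star (ξ p) * η q) * A p q =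
      inner ℂ (WithLp.toLp 2 ξ : EuclideanSpace ℂ ι)
        (Matrix.toEuclideanCLM (n := ι) (𝕜 := ℂ) A (WithLp.toLp 2 η)) := by
    rw [Matrix.toEuclideanCLM_toLp, PiLp.inner_apply]
    refine Finset.sum_congr rfl fun p _ => ?_
    simp only [RCLike.inner_apply, Matrix.mulVec, dotProduct, Finset.sum_mul]
    refine Finset.sum_congr rfl fun q _ => ?_
    rw [starRingEnd_apply]; ring
  rw [h, mul_assoc, Matrix.cstar_norm_def]
  exact (norm_inner_le_norm _ _).trans
    (mul_le_mul_of_nonneg_left (ContinuousLinearMap.le_opNorm _ _) (norm_nonneg _))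

theorem rectSandwich_smul_smul {m r : ℕ} (a b : ℂ) (α : Matrix (Fin m) (Fin r) ℂ)
    (x : Matrix (Fin r) (Fin r) X) (β : Matrix (Fin r) (Fin m) ℂ) :
    rectSandwich (a • α) x (b • β) = (a * b) • rectSandwich α x β := by
  ext i j
  simp only [rectSandwich, Matrix.smul_apply, smul_eq_mul, Finset.smul_sum, smul_smul]
  exact Finset.sum_congr rfl fun k _ => Finset.sum_congr rfl fun l _ => by congr 1; ring

theorem append_mul_conjTranspose {m r s : ℕ} (α : Matrix (Fin m) (Fin r) ℂ)
    (β : Matrix (Fin m) (Fin s) ℂ) :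
    (Matrix.of fun i => Fin.append (α i) (β i)) * (Matrix.of fun i => Fin.append (α i) (β i))ᴴ =
      α * αᴴ + β * βᴴ := by
  ext i j
  simp [Matrix.mul_apply, Fin.sum_univ_add]

theorem rectSandwich_append {m r s : ℕ} (α : Matrix (Fin m) (Fin r) ℂ)
    (α' : Matrix (Fin m) (Fin s) ℂ) (x : Matrix (Fin r) (Fin r) X) (x' : Matrix (Fin s) (Fin s) X)
    (β : Matrix (Fin m) (Fin r) ℂ) (β' : Matrix (Fin m) (Fin s) ℂ) :
    rectSandwich (Matrix.of fun i => Fin.append (α i) (α' i)) (directSum x x')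
      (Matrix.of fun i => Fin.append (β i) (β' i))ᴴ =
      rectSandwich α x βᴴ + rectSandwich α' x' β'ᴴ := by
  ext i j
  simp [rectSandwich, Fin.sum_univ_add]

/-- The cone of all `(ααᴴ, ββᴴ, 2 Re F(α x βᴴ))` with `x` in the closed unit ball of some `Mᵣ(X)`.
The last coordinate is kept complex so that the separating functional is complex linear. -/
def rectCone (S : OSS X) {m : ℕ} (F : Matrix (Fin m) (Fin m) X →ₗ[ℂ] ℂ) :
    Set (Matrix (Fin m) (Fin m) ℂ × Matrix (Fin m) (Fin m) ℂ × ℂ) :=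
  {d | ∃ (r : ℕ) (α β : Matrix (Fin m) (Fin r) ℂ) (x : Matrix (Fin r) (Fin r) X),
    S.mnorm r x ≤ 1 ∧ d = (α * αᴴ, β * βᴴ, ((2 * (F (rectSandwich α x βᴴ)).re : ℝ) : ℂ))}

/-- Sums stay in the cone since `x ⊕ x'` is in the unit ball when `x` and `x'` are. -/
theorem rectCone_add_mem (S : OSS X) {m : ℕ} (F : Matrix (Fin m) (Fin m) X →ₗ[ℂ] ℂ)
    {d d' : Matrix (Fin m) (Fin m) ℂ × Matrix (Fin m) (Fin m) ℂ × ℂ} (hd : d ∈ rectCone S F)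
    (hd' : d' ∈ rectCone S F) : d + d' ∈ rectCone S F := by
  obtain ⟨r, α, β, x, hx, rfl⟩ := hd
  obtain ⟨r', α', β', x', hx', rfl⟩ := hd'
  refine ⟨r + r', Matrix.of fun i => Fin.append (α i) (α' i),
    Matrix.of fun i => Fin.append (β i) (β' i), directSum x x', ?_, ?_⟩
  · rw [S.mnorm_directSum]; exact max_le hx hx'
  · rw [append_mul_conjTranspose, append_mul_conjTranspose, rectSandwich_append, map_add,
      Complex.add_re, mul_add, Complex.ofReal_add]
    rfl

theorem rectCone_smul_mem (S : OSS X) {m : ℕ} (F : Matrix (Fin m) (Fin m) X →ₗ[ℂ] ℂ)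
    {d : Matrix (Fin m) (Fin m) ℂ × Matrix (Fin m) (Fin m) ℂ × ℂ} (hd : d ∈ rectCone S F)
    {c : ℝ} (hc : 0 ≤ c) : c • d ∈ rectCone S F := by
  obtain ⟨r, α, β, x, hx, rfl⟩ := hd
  have hs : ((√c : ℝ) : ℂ) * ((√c : ℝ) : ℂ) = (c : ℂ) := by
    rw [← Complex.ofReal_mul, Real.mul_self_sqrt hc]
  have h1 : ∀ γ : Matrix (Fin m) (Fin r) ℂ,
      (((√c : ℝ) : ℂ) • γ) * (((√c : ℝ) : ℂ) • γ)ᴴ = c • (γ * γᴴ) := by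
    intro γ
    rw [Matrix.conjTranspose_smul, Matrix.smul_mul, Matrix.mul_smul, smul_smul]
    rw [← starRingEnd_apply, Complex.conj_ofReal, hs, Complex.coe_smul]
  refine ⟨r, ((√c : ℝ) : ℂ) • α, ((√c : ℝ) : ℂ) • β, x, hx, ?_⟩
  rw [h1, h1, Matrix.conjTranspose_smul, rectSandwich_smul_smul, ← starRingEnd_apply,
    Complex.conj_ofReal, hs, map_smul, smul_eq_mul, Complex.re_ofReal_mul]
  simp only [Prod.smul_mk]
  refine Prod.ext rfl (Prod.ext rfl ?_)
  simp only [Complex.real_smul]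
  push_cast; ring

/-- A contractive functional on `Mₘ(X)` is dominated by two positive functionals of mass at most
one: this is the Hahn–Banach separation of the cone `rectCone S F` from the open convex cone
`‖A‖ + ‖B‖ < Re t`. -/
theorem exists_positive_bound (S : OSS X) {m : ℕ} (F : Matrix (Fin m) (Fin m) X →ₗ[ℂ] ℂ)
    (hF : ∀ x, ‖F x‖ ≤ S.mnorm m x) :
    ∃ g h : Matrix (Fin m) (Fin m) ℂ →ₗ[ℂ] ℂ, (g 1).re ≤ 1 ∧ (h 1).re ≤ 1 ∧
      ∀ (r : ℕ) (α β : Matrix (Fin m) (Fin r) ℂ) (x : Matrix (Fin r) (Fin r) X),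
        S.mnorm r x ≤ 1 → 2 * (F (rectSandwich α x βᴴ)).re ≤
          (g (α * αᴴ)).re + (h (β * βᴴ)).re := by
  let M := Matrix (Fin m) (Fin m) ℂ
  let N : Set (M × M × ℂ) := {d | ‖d.1‖ + ‖d.2.1‖ < d.2.2.re}
  have hNo : IsOpen N := isOpen_lt (by fun_prop) (by fun_prop)
  have hNc : Convex ℝ N := by
    intro d hd d' hd' a b ha hb hab
    have e : ∀ (A B : M), ‖a • A + b • B‖ ≤ a * ‖A‖ + b * ‖B‖ := fun A B => by
      refine (norm_add_le _ _).trans ?_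
      rw [norm_smul, norm_smul, Real.norm_of_nonneg ha, Real.norm_of_nonneg hb]
    have h1 := e d.1 d'.1
    have h2 := e d.2.1 d'.2.1
    have hd1 : ‖d.1‖ + ‖d.2.1‖ < d.2.2.re := hd
    have hd2 : ‖d'.1‖ + ‖d'.2.1‖ < d'.2.2.re := hd'
    change ‖a • d.1 + b • d'.1‖ + ‖a • d.2.1 + b • d'.2.1‖ < (a • d.2.2 + b • d'.2.2).re
    rw [Complex.add_re, Complex.smul_re, Complex.smul_re, smul_eq_mul, smul_eq_mul]
    rcases ha.eq_or_lt with h0 | h0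
    · have hb1 : b = 1 := by linarith
      subst h0 hb1
      linarith
    · nlinarith [mul_lt_mul_of_pos_left hd1 h0, mul_le_mul_of_nonneg_left hd2.le hb]
  have hDc : Convex ℝ (rectCone S F) := fun d hd d' hd' a b ha hb _ =>
    rectCone_add_mem S F (rectCone_smul_mem S F hd ha) (rectCone_smul_mem S F hd' hb)
  -- a common point would violate `2 Re F(α x βᴴ) ≤ 2 ‖α‖ ‖β‖ ≤ ‖α‖² + ‖β‖²`
  have hdisj : Disjoint N (rectCone S F) := by
    rw [Set.disjoint_left]
    rintro _ hd ⟨r, α, β, x, hx, rfl⟩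
    have h1 : ‖α * αᴴ‖ + ‖β * βᴴ‖ < 2 * (F (rectSandwich α x βᴴ)).re := hd
    rw [l2_opNorm_mul_conjTranspose_self, l2_opNorm_mul_conjTranspose_self] at h1
    have h2 := (Complex.re_le_norm _).trans
      ((hF (rectSandwich α x βᴴ)).trans (S.mnorm_rectSandwich_le α x βᴴ))
    rw [Matrix.l2_opNorm_conjTranspose] at h2
    have h3 : ‖α‖ * S.mnorm r x * ‖β‖ ≤ ‖α‖ * 1 * ‖β‖ := by gcongr
    nlinarith [sq_nonneg (‖α‖ - ‖β‖)]
  obtain ⟨f, u, hN, hD⟩ := RCLike.geometric_hahn_banach_open (𝕜 := ℂ) hNc hNo hDc hdisj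
  have h0 : (0 : M × M × ℂ) ∈ rectCone S F :=
    ⟨0, 0, 0, 0, by rw [S.mnorm_zero]; exact zero_le_one, by
      have : (rectSandwich (0 : Matrix (Fin m) (Fin 0) ℂ) (0 : Matrix (Fin 0) (Fin 0) X) 0ᴴ) = 0 := by
        ext; simp [rectSandwich]
      rw [this]; simp; rfl⟩
  have hu : u ≤ 0 := by simpa using hD 0 h0
  -- `rectCone S F` is a cone, so `Re f` is not only bounded below on it but nonnegative
  have hD0 : ∀ d ∈ rectCone S F, 0 ≤ (f d).re := by
    intro d hd
    by_contra! hneg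
    have hc : 0 ≤ (u - 1) / (f d).re := div_nonneg_of_nonpos (by linarith) hneg.le
    have h1 := hD _ (rectCone_smul_mem S F hd hc)
    rw [← Complex.coe_smul, map_smul, smul_eq_mul] at h1
    have h2 : u ≤ (u - 1) / (f d).re * (f d).re := by
      rw [← Complex.re_ofReal_mul]; exact h1
    rw [div_mul_cancel₀ _ hneg.ne] at h2
    linarith
  have hN0 : ∀ d ∈ N, (f d).re < 0 := fun d hd => (hN d hd).trans_le hu
  set c : ℝ := -(f (0, 0, 1)).re with hc
  have hcpos : 0 < c := by
    have := hN0 (0, 0, 1) (by simp [N])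
    linarith
  have hsplit : ∀ (A B : M) (t : ℝ), (f (A, B, (t : ℂ))).re =
      (f (A, 0, 0)).re + (f (0, B, 0)).re - c * t := by
    intro A B t
    have e : ((A, B, (t : ℂ)) : M × M × ℂ) = (A, 0, 0) + (0, B, 0) + (t : ℂ) • (0, 0, 1) := by
      simp
    rw [e, map_add, map_add, map_smul, Complex.add_re, Complex.add_re, smul_eq_mul,
      Complex.re_ofReal_mul, hc]
    ring
  have h1le : ‖(1 : M)‖ ≤ 1 := norm_one_le
  have hbound : ∀ A B : M, ‖A‖ + ‖B‖ ≤ 1 → (f (A, 0, 0)).re + (f (0, B, 0)).re ≤ c := by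
    intro A B hAB
    refine le_of_forall_pos_le_add fun δ hδ => ?_
    have h2 := hN0 (A, B, ((1 + δ / c : ℝ) : ℂ)) (by
      change ‖A‖ + ‖B‖ < 1 + δ / c
      have : 0 < δ / c := by positivity
      linarith)
    rw [hsplit] at h2
    have : c * (1 + δ / c) = c + δ := by field_simp
    linarith
  let iA : M →ₗ[ℂ] M × M × ℂ := LinearMap.inl ℂ M (M × ℂ)
  let iB : M →ₗ[ℂ] M × M × ℂ := LinearMap.inr ℂ M (M × ℂ) ∘ₗ LinearMap.inl ℂ M ℂ
  refine ⟨((c⁻¹ : ℝ) : ℂ) • (f.toLinearMap ∘ₗ iA), ((c⁻¹ : ℝ) : ℂ) • (f.toLinearMap ∘ₗ iB),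
    ?_, ?_, fun r α β x hx => ?_⟩
  · change (((c⁻¹ : ℝ) : ℂ) * f (1, 0, 0)).re ≤ 1
    have h2 := hbound 1 0 (by simpa using h1le)
    rw [show ((0, 0, 0) : M × M × ℂ) = 0 from rfl, map_zero, Complex.zero_re, add_zero] at h2
    rw [Complex.re_ofReal_mul, inv_mul_le_iff₀ hcpos, mul_one]
    exact h2
  · change (((c⁻¹ : ℝ) : ℂ) * f (0, 1, 0)).re ≤ 1
    have h2 := hbound 0 1 (by simpa using h1le)
    rw [show ((0, 0, 0) : M × M × ℂ) = 0 from rfl, map_zero, Complex.zero_re, zero_add] at h2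
    rw [Complex.re_ofReal_mul, inv_mul_le_iff₀ hcpos, mul_one]
    exact h2
  · change _ ≤ (((c⁻¹ : ℝ) : ℂ) * f (α * αᴴ, 0, 0)).re + (((c⁻¹ : ℝ) : ℂ) * f (0, β * βᴴ, 0)).re
    have h2 := hD0 _ ⟨r, α, β, x, hx, rfl⟩
    rw [hsplit] at h2
    rw [Complex.re_ofReal_mul, Complex.re_ofReal_mul, ← mul_add, ← div_eq_inv_mul, le_div_iff₀ hcpos]
    linarith

end positiveBound

/-! ### Norming complete contractions into matrix algebras -/

section normingMatrix

open Matrix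

variable {X : Type*} [NormedAddCommGroup X] [NormedSpace ℂ X]

/-- Optimization over `t`, at `t² = v / u`; both numbers are moved away from zero first. -/
theorem le_mul_of_two_mul_le {b u v : ℝ} (hu : 0 ≤ u) (hv : 0 ≤ v)
    (h : ∀ t : ℝ, 0 < t → 2 * b ≤ t ^ 2 * u ^ 2 + (t⁻¹) ^ 2 * v ^ 2) : b ≤ u * v := by
  have key : ∀ δ : ℝ, 0 < δ → b ≤ (u + δ) * (v + δ) := by
    intro δ hδ
    have hu' : 0 < u + δ := by linarith
    have hv' : 0 < v + δ := by linarith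
    have h1 := h (√((v + δ) / (u + δ))) (by positivity)
    rw [inv_pow, Real.sq_sqrt (by positivity)] at h1
    have h2 : (v + δ) / (u + δ) * u ^ 2 ≤ (v + δ) / (u + δ) * (u + δ) ^ 2 := by gcongr; linarith
    have h3 : ((v + δ) / (u + δ))⁻¹ * v ^ 2 ≤ ((v + δ) / (u + δ))⁻¹ * (v + δ) ^ 2 := by
      gcongr; linarith
    have h4 : (v + δ) / (u + δ) * (u + δ) ^ 2 = (u + δ) * (v + δ) := by field_simp
    have h5 : ((v + δ) / (u + δ))⁻¹ * (v + δ) ^ 2 = (u + δ) * (v + δ) := by field_simp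
    linarith
  have ht : Filter.Tendsto (fun δ : ℝ => (u + δ) * (v + δ)) (nhdsWithin 0 (Set.Ioi 0))
      (nhds (u * v)) := by
    have : Continuous fun δ : ℝ => (u + δ) * (v + δ) := by fun_prop
    simpa using (this.tendsto 0).mono_left nhdsWithin_le_nhds
  exact ge_of_tendsto ht (eventually_nhdsWithin_of_forall key)

/-- The estimate `2 Re F(α x βᴴ) ≤ ‖Rα‖₂² + ‖Qβ‖₂²`, with Hilbert–Schmidt norms, in its homogeneous
form. -/
theorem norm_le_of_two_mul_re_le {m r : ℕ} (F : Matrix (Fin m) (Fin m) X →ₗ[ℂ] ℂ)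
    {R Q : Matrix (Fin m) (Fin m) ℂ} {x : Matrix (Fin r) (Fin r) X}
    (h : ∀ α β : Matrix (Fin m) (Fin r) ℂ, 2 * (F (rectSandwich α x βᴴ)).re ≤
      ∑ i, ∑ j, ‖(R * α) i j‖ ^ 2 + ∑ i, ∑ j, ‖(Q * β) i j‖ ^ 2)
    (α β : Matrix (Fin m) (Fin r) ℂ) : ‖F (rectSandwich α x βᴴ)‖ ≤
      √(∑ i, ∑ j, ‖(R * α) i j‖ ^ 2) * √(∑ i, ∑ j, ‖(Q * β) i j‖ ^ 2) := by
  refine le_mul_of_two_mul_le (Real.sqrt_nonneg _) (Real.sqrt_nonneg _) fun t ht => ?_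
  rw [Real.sq_sqrt (by positivity), Real.sq_sqrt (by positivity)]
  set w := F (rectSandwich α x βᴴ) with hw
  -- a phase that makes `w` nonnegative
  obtain ⟨c, hc, hcw⟩ : ∃ c : ℂ, ‖c‖ = 1 ∧ c * w = (‖w‖ : ℂ) := by
    obtain ⟨c, hc, h⟩ := RCLike.exists_norm_eq_mul_self (K := ℂ) w
    exact ⟨c, hc, h.symm⟩
  have h1 := h (((t : ℝ) : ℂ) • α) ((star c * ((t⁻¹ : ℝ) : ℂ)) • β)
  have e : ((t : ℝ) : ℂ) * star (star c * ((t⁻¹ : ℝ) : ℂ)) = c := by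
    rw [star_mul, star_star, ← starRingEnd_apply, Complex.conj_ofReal, ← mul_assoc,
      ← Complex.ofReal_mul, mul_inv_cancel₀ ht.ne', Complex.ofReal_one, one_mul]
  rw [Matrix.conjTranspose_smul, rectSandwich_smul_smul, e, map_smul, smul_eq_mul, ← hw, hcw,
    Complex.ofReal_re] at h1
  refine h1.trans (le_of_eq ?_)
  simp only [Matrix.mul_smul, Matrix.smul_apply, norm_smul, mul_pow, ← Finset.mul_sum, norm_mul,
    norm_star, hc, Complex.norm_real, one_mul, Real.norm_eq_abs, sq_abs]

/-- The linear map `y ↦ [A p s · conj (B q t) · y]_{p q}`. -/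
def entryMap {m : ℕ} (A B : Matrix (Fin m) (Fin m) ℂ) (s t : Fin m) :
    X →ₗ[ℂ] Matrix (Fin m) (Fin m) X where
  toFun y := Matrix.of fun p q => (A p s * star (B q t)) • y
  map_add' y z := by ext; simp
  map_smul' c y := by ext; simp [smul_comm c]

theorem entryMap_apply {m : ℕ} (A B : Matrix (Fin m) (Fin m) ℂ) (s t p q : Fin m) (y : X) :
    entryMap A B s t y p q = (A p s * star (B q t)) • y := rfl

/-- The matrix of functionals `φ s t = F ∘ entryMap A B s t`. -/
def functionalMatrix (S : OSS X) {m : ℕ} (F : Matrix (Fin m) (Fin m) X →ₗ[ℂ] ℂ)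
    (hF : ∀ x, ‖F x‖ ≤ S.mnorm m x) (A B : Matrix (Fin m) (Fin m) ℂ) :
    Matrix (Fin m) (Fin m) (StrongDual ℂ X) :=
  Matrix.of fun s t => LinearMap.mkContinuous (F ∘ₗ entryMap A B s t)
    (∑ p, ∑ q, ‖A p s * star (B q t)‖) fun y => by
      refine (hF _).trans ((S.mnorm_le_sum _).trans (le_of_eq ?_))
      simp only [entryMap_apply, norm_smul, Finset.sum_mul]

/-- The sesquilinear form of `[φ s t (x k l)]` at `ξ`, `η` is the value of `F` at a rectangular
compression of `x`, whose outer factors carry `ξ` and `η`. -/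
theorem form_functionalMatrix (S : OSS X) {m r : ℕ} (F : Matrix (Fin m) (Fin m) X →ₗ[ℂ] ℂ)
    (hF : ∀ x, ‖F x‖ ≤ S.mnorm m x) (A B : Matrix (Fin m) (Fin m) ℂ)
    (x : Matrix (Fin r) (Fin r) X) (ξ η : Fin r × Fin m → ℂ) :
    ∑ a, ∑ b, (star (ξ a) * η b) * pairMatrix (functionalMatrix S F hF A B) x a b =
      F (rectSandwich (A * Matrix.of fun s k => star (ξ (k, s))) x
        (B * Matrix.of fun t l => star (η (l, t)))ᴴ) := by
  have h : ∀ a b, (star (ξ a) * η b) * pairMatrix (functionalMatrix S F hF A B) x a b =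
      F ((star (ξ a) * η b) • entryMap A B a.2 b.2 (x a.1 b.1)) := by
    intro a b
    rw [map_smul]; rfl
  simp_rw [h, ← map_sum]
  congr 1
  ext p q
  simp only [Matrix.sum_apply, Matrix.smul_apply, entryMap_apply, rectSandwich, Matrix.mul_apply,
    Matrix.conjTranspose_apply, Matrix.of_apply, Fintype.sum_prod_type, star_sum, star_mul',
    star_star, Finset.sum_mul_sum, Finset.sum_smul, smul_smul]
  refine Finset.sum_congr rfl fun k _ => ?_
  rw [Finset.sum_comm]
  refine Finset.sum_congr rfl fun l _ => Finset.sum_congr rfl fun s _ =>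
    Finset.sum_congr rfl fun t _ => ?_
  congr 1; ring

theorem norm_toLp_prod_sq {r m : ℕ} (ξ : Fin r × Fin m → ℂ) :
    ‖(WithLp.toLp 2 ξ : EuclideanSpace ℂ (Fin r × Fin m))‖ ^ 2 =
      ∑ s, ∑ k, ‖star (ξ (k, s))‖ ^ 2 := by
  rw [EuclideanSpace.norm_sq_eq, Fintype.sum_prod_type, Finset.sum_comm]
  simp only [norm_star]

/-- Ruan's lemma: the norm of `z ∈ Mₘ(X)` is nearly attained by the amplification of a complete
contraction `X → Mₘ`. -/
theorem OSS.exists_norming_matrix (S : OSS X) {m : ℕ} (z : Matrix (Fin m) (Fin m) X) {ε : ℝ}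
    (hε : 0 < ε) : ∃ φ : Matrix (Fin m) (Fin m) (StrongDual ℂ X), S.dualNorm m φ ≤ 1 ∧
      S.mnorm m z ≤ (1 + ε) * ‖pairMatrix φ z‖ := by
  obtain ⟨F, hF, hFz⟩ := S.exists_norming z
  obtain ⟨g, h, hg1, hh1, hgh⟩ := exists_positive_bound S F hF
  have hg : ∀ (r : ℕ) (α : Matrix (Fin m) (Fin r) ℂ), 0 ≤ (g (α * αᴴ)).re := by
    intro r α
    have := hgh r α 0 0 (by rw [S.mnorm_zero]; exact zero_le_one)
    have e : rectSandwich α (0 : Matrix (Fin r) (Fin r) X) (0 : Matrix (Fin m) (Fin r) ℂ)ᴴ = 0 := by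
      ext; simp [rectSandwich]
    rw [e] at this
    simpa using this
  have hh : ∀ (r : ℕ) (α : Matrix (Fin m) (Fin r) ℂ), 0 ≤ (h (α * αᴴ)).re := by
    intro r α
    have := hgh r 0 α 0 (by rw [S.mnorm_zero]; exact zero_le_one)
    have e : rectSandwich 0 (0 : Matrix (Fin r) (Fin r) X) αᴴ = 0 := by
      ext; simp [rectSandwich]
    rw [e] at this
    simpa using this
  set δ : ℝ := ε / (m + 1) with hδ
  have hδ0 : 0 < δ := by positivity
  have hmδ : m * δ ≤ ε := by
    rw [hδ, ← mul_div_assoc, div_le_iff₀ (by positivity)]; nlinarith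
  obtain ⟨R, hR, hRg, hRs⟩ := exists_density g hg hδ0
  obtain ⟨Q, hQ, hQh, hQs⟩ := exists_density h hh hδ0
  have hRi : R * R⁻¹ = 1 := Matrix.mul_nonsing_inv R ((Matrix.isUnit_iff_isUnit_det R).1 hR)
  have hQi : Q * Q⁻¹ = 1 := Matrix.mul_nonsing_inv Q ((Matrix.isUnit_iff_isUnit_det Q).1 hQ)
  have hRi' : R⁻¹ * R = 1 := Matrix.nonsing_inv_mul R ((Matrix.isUnit_iff_isUnit_det R).1 hR)
  have hQi' : Q⁻¹ * Q = 1 := Matrix.nonsing_inv_mul Q ((Matrix.isUnit_iff_isUnit_det Q).1 hQ)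
  refine ⟨functionalMatrix S F hF R⁻¹ Q⁻¹, dualNorm_le S fun r x hx => ?_, ?_⟩
  · refine norm_le_of_form _ zero_le_one fun ξ η => ?_
    rw [form_functionalMatrix, mul_one]
    refine (norm_le_of_two_mul_re_le (R := R) (Q := Q) F (fun α β => (hgh r α β x hx).trans
      (add_le_add (hRg r α) (hQh r β))) _ _).trans (le_of_eq ?_)
    rw [← Matrix.mul_assoc, hRi, Matrix.one_mul, ← Matrix.mul_assoc, hQi, Matrix.one_mul]
    simp only [Matrix.of_apply]
    rw [← norm_toLp_prod_sq, ← norm_toLp_prod_sq, Real.sqrt_sq (norm_nonneg _),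
      Real.sqrt_sq (norm_nonneg _)]
  · -- the vectors with coordinates `R` and `Q` recover `F` from the functionals
    set ξ : Fin m × Fin m → ℂ := fun a => star (R a.2 a.1) with hξ
    set η : Fin m × Fin m → ℂ := fun a => star (Q a.2 a.1) with hη
    have h1 := form_functionalMatrix S F hF R⁻¹ Q⁻¹ z ξ η
    have e1 : (Matrix.of fun s k => star (ξ (k, s))) = R := by ext; simp [hξ]
    have e2 : (Matrix.of fun s k => star (η (k, s))) = Q := by ext; simp [hη]
    have e3 : rectSandwich (1 : Matrix (Fin m) (Fin m) ℂ) z (1 : Matrix (Fin m) (Fin m) ℂ)ᴴ = z := by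
      ext i j; simp [rectSandwich, Matrix.one_apply]
    rw [e1, e2, hRi', hQi', e3, hFz] at h1
    have h2 := norm_form_le_opNorm (pairMatrix (functionalMatrix S F hF R⁻¹ Q⁻¹) z) ξ η
    rw [h1, Complex.norm_real, Real.norm_of_nonneg (S.mnorm_nonneg z)] at h2
    have h3 := norm_toLp_prod_sq ξ
    have h4 := norm_toLp_prod_sq η
    simp only [hξ, hη, star_star] at h3 h4
    rw [hRs] at h3
    rw [hQs] at h4
    rw [← hξ] at h3
    rw [← hη] at h4
    refine h2.trans ?_
    set a := ‖(WithLp.toLp 2 ξ : EuclideanSpace ℂ (Fin m × Fin m))‖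
    set b := ‖(WithLp.toLp 2 η : EuclideanSpace ℂ (Fin m × Fin m))‖
    have hab : a * b ≤ 1 + ε := by nlinarith [sq_nonneg (a - b)]
    calc _ = (a * b) * ‖pairMatrix (functionalMatrix S F hF R⁻¹ Q⁻¹) z‖ := by ring
      _ ≤ _ := by gcongr

end normingMatrix

/-! ### The universal property of `Tₙ` -/

section universal

open Matrix

variable {V : Type*} [NormedAddCommGroup V] [NormedSpace ℂ V] (S : OSS V)

theorem norm_pairMatrix_le {k m : ℕ} (φ : Matrix (Fin k) (Fin k) (StrongDual ℂ V))
    (v : Matrix (Fin m) (Fin m) V) : ‖pairMatrix φ v‖ ≤ S.dualNorm k φ * S.mnorm m v := by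
  rcases (S.mnorm_nonneg v).eq_or_lt with h0 | h0
  · rw [S.eq_zero_of_mnorm m v h0.symm, S.mnorm_zero, mul_zero]
    have : pairMatrix φ (0 : Matrix (Fin m) (Fin m) V) = 0 := by ext; simp [pairMatrix]
    rw [this, norm_zero]
  · set c : ℂ := (((S.mnorm m v)⁻¹ : ℝ) : ℂ) with hc
    have hcn : ‖c‖ = (S.mnorm m v)⁻¹ := by
      rw [hc, Complex.norm_real, Real.norm_of_nonneg (by positivity)]
    have h1 := le_dualNorm S φ (c • v) (by rw [S.mnorm_smul, hcn, inv_mul_cancel₀ h0.ne'])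
    have e : pairMatrix φ (c • v) = c • pairMatrix φ v := by ext; simp [pairMatrix]
    rw [e, norm_smul, hcn, inv_mul_le_iff₀ h0, mul_comm] at h1
    exact h1

/-- The norm of `Mₘ(Mₙ)` is the operator norm of the flattened matrix of size `mn`. -/
theorem cstarNorm_matrix {m n : ℕ} (b : Matrix (Fin m) (Fin m) (Matrix (Fin n) (Fin n) ℂ)) :
    cstarNorm (Matrix (Fin n) (Fin n) ℂ) m b =
      ‖(Matrix.of fun x y => b x.1 y.1 x.2 y.2 : Matrix (Fin m × Fin n) (Fin m × Fin n) ℂ)‖ := by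
  let _ := CStarAlgebra.spectralOrder (Matrix (Fin n) (Fin n) ℂ)
  have _ := CStarAlgebra.spectralOrderedRing (Matrix (Fin n) (Fin n) ℂ)
  let f : CStarMatrix (Fin m) (Fin m) (Matrix (Fin n) (Fin n) ℂ) →⋆ₙₐ[ℂ]
      Matrix (Fin m × Fin n) (Fin m × Fin n) ℂ :=
    { toFun := fun b => Matrix.of fun x y => b x.1 y.1 x.2 y.2
      map_smul' := fun _ _ => rfl
      map_zero' := rfl
      map_add' := fun _ _ => rfl
      map_mul' := fun a b => by
        ext x y
        simp only [Matrix.of_apply, CStarMatrix.mul_apply, Matrix.sum_apply, Matrix.mul_apply,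
          Fintype.sum_prod_type]
      map_star' := fun _ => rfl }
  have hf : Function.Injective f := fun a b h => by
    ext p q i j
    exact congrFun (congrFun h (p, i)) (q, j)
  exact (NonUnitalStarAlgHom.norm_map f hf (CStarMatrix.ofMatrix b)).symm

/-- The linear map `a ↦ ∑ i j, a i j • y i j` from `Tₙ` that corresponds to `y ∈ Mₙ(V)`. -/
def TMat.lift {n : ℕ} (y : Matrix (Fin n) (Fin n) V) : TMat n →ₗ[ℂ] V where
  toFun a := ∑ i, ∑ j, (show Matrix (Fin n) (Fin n) ℂ from a) i j • y i j
  map_add' a b := by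
    simp only [← Finset.sum_add_distrib, ← add_smul]
    rfl
  map_smul' c a := by
    simp only [RingHom.id_apply, Finset.smul_sum, smul_smul]
    rfl

theorem TMat.lift_apply {n : ℕ} (y : Matrix (Fin n) (Fin n) V) (a : TMat n) :
    TMat.lift y a = ∑ i, ∑ j, (show Matrix (Fin n) (Fin n) ℂ from a) i j • y i j := rfl

theorem TMat.toDual_apply {n : ℕ} (a : TMat n) (b : Matrix (Fin n) (Fin n) ℂ) :
    TMat.toDual n a b = ∑ i, ∑ j, (show Matrix (Fin n) (Fin n) ℂ from a) i j * b i j := rfl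

/-- The unit ball of `Mₙ(V)` consists of linear complete contractions on `Tₙ`. By Ruan's lemma it
is enough to check this after composition with complete contractions into matrix algebras, for
which it is the definition of the dual operator space `Tₙ = Mₙ*`. -/
theorem TMat.mnorm_map_lift_le {n : ℕ} {y : Matrix (Fin n) (Fin n) V} (hy : S.mnorm n y ≤ 1)
    {m : ℕ} (a : Matrix (Fin m) (Fin m) (TMat n)) :
    S.mnorm m (a.map (TMat.lift y)) ≤ (OSS.tMat n).mnorm m a := by
  set C := (OSS.tMat n).mnorm m a with hC
  have hC0 : 0 ≤ C := (OSS.tMat n).mnorm_nonneg a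
  refine le_of_forall_pos_le_add fun δ hδ => ?_
  obtain ⟨φ, hφ, hz⟩ := S.exists_norming_matrix (a.map (TMat.lift y))
    (show 0 < δ / (C + 1) by positivity)
  -- the image of `y` under the amplification of `φ`, in the unit ball of `Mₘ(Mₙ)`
  let v : Matrix (Fin m) (Fin m) (Matrix (Fin n) (Fin n) ℂ) := fun s t i j => φ s t (y i j)
  have hv : cstarNorm (Matrix (Fin n) (Fin n) ℂ) m v ≤ 1 := by
    rw [cstarNorm_matrix, ← norm_submatrix_equiv (Equiv.prodComm (Fin n) (Fin m))]
    exact (norm_pairMatrix_le S φ y).trans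
      (mul_le_one₀ hφ (S.mnorm_nonneg y) hy)
  have h1 : ‖pairMatrix φ (a.map (TMat.lift y))‖ ≤ C := by
    have h2 : ‖pairMatrix (a.map (TMat.toDual n)) v‖ ≤ C :=
      le_dualNorm (OSS.cstar (Matrix (Fin n) (Fin n) ℂ)) _ v hv
    rw [← norm_submatrix_equiv (Equiv.prodComm (Fin m) (Fin m))] at h2
    convert h2 using 2
    ext x z
    simp [pairMatrix, TMat.lift_apply]
    rfl
  have h3 : δ / (C + 1) * C ≤ δ := by
    rw [div_mul_eq_mul_div, div_le_iff₀ (by positivity)]; nlinarith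
  calc _ ≤ (1 + δ / (C + 1)) * ‖pairMatrix φ (a.map (TMat.lift y))‖ := hz
    _ ≤ (1 + δ / (C + 1)) * C := by gcongr
    _ ≤ _ := by linarith

/-- The element `[E i j]` of `Mₙ(Tₙ)`, which corresponds to the identity of `Mₙ`. -/
def TMat.universal (n : ℕ) : Matrix (Fin n) (Fin n) (TMat n) :=
  fun i j => (Matrix.single i j 1 : Matrix (Fin n) (Fin n) ℂ)

theorem TMat.toDual_universal {n : ℕ} (i j : Fin n) (b : Matrix (Fin n) (Fin n) ℂ) :
    TMat.toDual n (TMat.universal n i j) b = b i j := by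
  change ∑ k, ∑ l, (Matrix.single i j 1 : Matrix (Fin n) (Fin n) ℂ) k l * b k l = _
  rw [Finset.sum_eq_single i, Finset.sum_eq_single j]
  · simp
  · intro l _ hl; simp [Ne.symm hl]
  · simp
  · intro k _ hk; simp [Ne.symm hk]
  · simp

theorem TMat.lift_universal {n : ℕ} (y : Matrix (Fin n) (Fin n) V) (i j : Fin n) :
    TMat.lift y (TMat.universal n i j) = y i j := by
  change ∑ k, ∑ l, (Matrix.single i j 1 : Matrix (Fin n) (Fin n) ℂ) k l • y k l = _
  rw [Finset.sum_eq_single i, Finset.sum_eq_single j]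
  · simp
  · intro l _ hl; simp [Ne.symm hl]
  · simp
  · intro k _ hk; simp [Ne.symm hk]
  · simp

theorem TMat.mnorm_universal_le (n : ℕ) : (OSS.tMat n).mnorm n (TMat.universal n) ≤ 1 := by
  refine dualNorm_le _ fun m v hv => ?_
  have h : cstarNorm (Matrix (Fin n) (Fin n) ℂ) m v ≤ 1 := hv
  rw [cstarNorm_matrix] at h
  convert h using 2
  ext x z
  exact TMat.toDual_universal x.2 z.2 (v x.1 z.1)

theorem TMat.apply_eq_sum {n : ℕ} (f : TMat n →ₗ[ℂ] V) (a : TMat n) :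
    f a = ∑ i, ∑ j, (show Matrix (Fin n) (Fin n) ℂ from a) i j • f (TMat.universal n i j) := by
  have e : a = ∑ i, ∑ j, (show Matrix (Fin n) (Fin n) ℂ from a) i j • TMat.universal n i j := by
    conv_lhs => rw [show a = _ from
      Matrix.matrix_eq_sum_single (show Matrix (Fin n) (Fin n) ℂ from a)]
    refine Finset.sum_congr rfl fun i _ => Finset.sum_congr rfl fun j _ => ?_
    change _ = (show Matrix (Fin n) (Fin n) ℂ from a) i j •
      (Matrix.single i j 1 : Matrix (Fin n) (Fin n) ℂ)
    simp
  conv_lhs => rw [e]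
  simp only [map_sum, map_smul]

theorem TMat.eq_of_universal {n : ℕ} {f g : TMat n →ₗ[ℂ] V}
    (h : ∀ i j, f (TMat.universal n i j) = g (TMat.universal n i j)) : f = g := by
  ext a
  rw [TMat.apply_eq_sum f, TMat.apply_eq_sum g]
  simp only [h]

end universal

/-! ### A criterion for strong generators -/

section generator

universe w

open CategoryTheory

/-- The universal element `[E i j]` of `Mₙ(Tₙ)`. -/
def OS.universalT (n : ℕ) : Matrix (Fin n) (Fin n) (OS.T n).carrier := TMat.universal n

/-- The complete contraction on `Tₙ` that corresponds to an element of the unit ball of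
`Mₙ(Y)`. -/
def OS.liftT {Y : OS.{u}} {n : ℕ} (y : Matrix (Fin n) (Fin n) Y.carrier)
    (hy : Y.oss.mnorm n y ≤ 1) : OS.Hom (OS.T n) Y where
  toLinearMap := TMat.lift y
  mnorm_map_le _ a := TMat.mnorm_map_lift_le Y.oss hy a

theorem OS.liftT_universalT {Y : OS.{u}} {n : ℕ} (y : Matrix (Fin n) (Fin n) Y.carrier)
    (hy : Y.oss.mnorm n y ≤ 1) (i j : Fin n) :
    (OS.liftT y hy).toLinearMap (OS.universalT n i j) = y i j :=
  TMat.lift_universal y i j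

/-- The complete contraction on `T₁` that corresponds to an element of the unit ball of `Y`. -/
def OS.liftT₁ {Y : OS.{u}} (y : Y.carrier) (hy : ‖y‖ ≤ 1) : OS.Hom (OS.T 1) Y :=
  OS.liftT (Matrix.of fun _ _ => y) ((Y.oss.mnorm_one y).trans_le hy)

theorem OS.liftT₁_universalT {Y : OS.{u}} (y : Y.carrier) (hy : ‖y‖ ≤ 1) (i j : Fin 1) :
    (OS.liftT₁ y hy).toLinearMap (OS.universalT 1 i j) = y :=
  OS.liftT_universalT _ _ i j

/-- Composition of complete contractions, across universes. -/
def OS.Hom.trans {X : OS.{u}} {Y : OS.{v}} {Z : OS.{w}} (f : OS.Hom X Y) (g : OS.Hom Y Z) :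
    OS.Hom X Z where
  toLinearMap := g.toLinearMap ∘ₗ f.toLinearMap
  mnorm_map_le n x := (g.mnorm_map_le n (x.map f.toLinearMap)).trans (f.mnorm_map_le n x)

theorem OS.Hom.trans_apply {X : OS.{u}} {Y : OS.{v}} {Z : OS.{w}} (f : OS.Hom X Y)
    (g : OS.Hom Y Z) (x : X.carrier) :
    (f.trans g).toLinearMap x = g.toLinearMap (f.toLinearMap x) := rfl

theorem OS.comp_apply {X Y Z : OS.{u}} (f : X ⟶ Y) (g : Y ⟶ Z) (x : X.carrier) :
    (f ≫ g).toLinearMap x = g.toLinearMap (f.toLinearMap x) := rfl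

/-- An operator space that contains every `Tₙ` as a completely contractive retract. -/
def OS.HasRetractsT (G : OS.{u}) : Prop :=
  ∀ n : ℕ, ∃ (s : OS.Hom (OS.T n) G) (p : OS.Hom G (OS.T n)),
    ∀ a, p.toLinearMap (s.toLinearMap a) = a

theorem exists_smul_norm_le_one {E : Type*} [NormedAddCommGroup E] [NormedSpace ℂ E] (x : E) :
    ∃ c : ℂ, c ≠ 0 ∧ ‖c • x‖ ≤ 1 := by
  refine ⟨(((‖x‖ + 1)⁻¹ : ℝ) : ℂ), ?_, ?_⟩
  · have : (‖x‖ + 1)⁻¹ ≠ 0 := by positivity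
    exact_mod_cast this
  · rw [norm_smul, Complex.norm_real, Real.norm_of_nonneg (by positivity),
      inv_mul_le_iff₀ (by positivity)]
    linarith

theorem OS.HasRetractsT.ext {G : OS.{u}} (hG : G.HasRetractsT) {X Y : OS.{u}} {f g : X ⟶ Y}
    (h : ∀ k : G ⟶ X, k ≫ f = k ≫ g) : f = g := by
  refine OS.Hom.ext (LinearMap.ext fun x => ?_)
  obtain ⟨c, hc, hx⟩ := exists_smul_norm_le_one x
  obtain ⟨s, p, hsp⟩ := hG 1
  have h1 := LinearMap.congr_fun (congrArg OS.Hom.toLinearMap (h (p.trans (OS.liftT₁ _ hx))))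
    (s.toLinearMap (OS.universalT 1 0 0))
  rw [OS.comp_apply, OS.comp_apply, OS.Hom.trans_apply, hsp, OS.liftT₁_universalT, map_smul,
    map_smul] at h1
  exact smul_right_injective _ hc h1

/-- A monomorphism through which all morphisms from `G` factor is an isomorphism: the unit balls of
all `Mₙ(Y)` then lift to those of `Mₙ(X)`, since they are the sets of morphisms out of `Tₙ`. -/
theorem OS.HasRetractsT.isIso {G : OS.{u}} (hG : G.HasRetractsT) {X Y : OS.{u}} (i : X ⟶ Y)
    [Mono i] (h : ∀ k : G ⟶ Y, ∃ l : G ⟶ X, l ≫ i = k) : IsIso i := by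
  have hinj : Function.Injective i.toLinearMap := by
    refine (injective_iff_map_eq_zero i.toLinearMap).2 fun x hx => ?_
    obtain ⟨c, hc, hx1⟩ := exists_smul_norm_le_one x
    obtain ⟨s, p, hsp⟩ := hG 1
    have hx0 : ‖(0 : X.carrier)‖ ≤ 1 := by simp
    let a : G ⟶ X := p.trans (OS.liftT₁ _ hx1)
    let b : G ⟶ X := p.trans (OS.liftT₁ _ hx0)
    have hab : a ≫ i = b ≫ i := by
      refine OS.Hom.ext (LinearMap.ext fun t => ?_)
      have e : ∀ (y : X.carrier) (hy : ‖y‖ ≤ 1), i.toLinearMap y = 0 →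
          i.toLinearMap ∘ₗ (OS.liftT₁ y hy).toLinearMap = 0 := fun y hy hiy =>
        TMat.eq_of_universal fun j k =>
          (congrArg i.toLinearMap (OS.liftT₁_universalT y hy j k)).trans hiy
      exact (LinearMap.congr_fun (e _ hx1 (by rw [map_smul, hx, smul_zero])) _).trans
        (LinearMap.congr_fun (e _ hx0 (map_zero _)) _).symm
    have h1 := LinearMap.congr_fun (congrArg OS.Hom.toLinearMap ((cancel_mono i).1 hab))
      (s.toLinearMap (OS.universalT 1 0 0))
    rw [OS.Hom.trans_apply, OS.Hom.trans_apply, hsp, OS.liftT₁_universalT,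
      OS.liftT₁_universalT] at h1
    exact (smul_eq_zero.1 h1).resolve_left hc
  have hball : ∀ (n : ℕ) (y : Matrix (Fin n) (Fin n) Y.carrier), Y.oss.mnorm n y ≤ 1 →
      ∃ x : Matrix (Fin n) (Fin n) X.carrier, X.oss.mnorm n x ≤ 1 ∧ x.map i.toLinearMap = y := by
    intro n y hy
    obtain ⟨s, p, hsp⟩ := hG n
    obtain ⟨l, hl⟩ := h (p.trans (OS.liftT y hy))
    refine ⟨(OS.universalT n).map (s.trans l).toLinearMap,
      ((s.trans l).mnorm_map_le n _).trans (TMat.mnorm_universal_le n), ?_⟩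
    ext a b
    have h1 := LinearMap.congr_fun (congrArg OS.Hom.toLinearMap hl)
      (s.toLinearMap (OS.universalT n a b))
    rw [OS.comp_apply, OS.Hom.trans_apply, hsp, OS.liftT_universalT] at h1
    exact h1
  have hsurj : Function.Surjective i.toLinearMap := by
    intro y
    obtain ⟨c, hc, hy⟩ := exists_smul_norm_le_one y
    obtain ⟨x, -, hx⟩ := hball 1 (Matrix.of fun _ _ => c • y)
      ((Y.oss.mnorm_one _).trans_le hy)
    refine ⟨c⁻¹ • x 0 0, ?_⟩
    have h1 : i.toLinearMap (x 0 0) = c • y := congrFun (congrFun hx 0) 0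
    rw [map_smul, h1, smul_smul, inv_mul_cancel₀ hc, one_smul]
  let E := LinearEquiv.ofBijective i.toLinearMap ⟨hinj, hsurj⟩
  have hE : ∀ y, i.toLinearMap (E.symm y) = y := fun y => E.apply_symm_apply y
  have hEn : ∀ (n : ℕ) (y : Matrix (Fin n) (Fin n) Y.carrier),
      X.oss.mnorm n (y.map E.symm.toLinearMap) ≤ Y.oss.mnorm n y := by
    intro n y
    -- `y / t` lies in the unit ball for every `t > ‖y‖`
    refine le_of_forall_gt_imp_ge_of_dense fun t ht => ?_
    have ht0 : 0 < t := (Y.oss.mnorm_nonneg y).trans_lt ht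
    have htn : ‖((t⁻¹ : ℝ) : ℂ)‖ = t⁻¹ := by
      rw [Complex.norm_real, Real.norm_of_nonneg (by positivity)]
    obtain ⟨x, hx, hxy⟩ := hball n (((t⁻¹ : ℝ) : ℂ) • y) (by
      rw [Y.oss.mnorm_smul, htn, inv_mul_le_iff₀ ht0, mul_one]; exact ht.le)
    have e : x = ((t⁻¹ : ℝ) : ℂ) • y.map E.symm.toLinearMap := by
      ext a b
      apply hinj
      refine (congrFun (congrFun hxy a) b).trans ?_
      change ((t⁻¹ : ℝ) : ℂ) • y a b = i.toLinearMap (((t⁻¹ : ℝ) : ℂ) • E.symm (y a b))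
      rw [map_smul, hE]
    rw [e, X.oss.mnorm_smul, htn, inv_mul_le_iff₀ ht0, mul_one] at hx
    exact hx
  let j : Y ⟶ X := ⟨E.symm.toLinearMap, hEn⟩
  exact ⟨j, OS.Hom.ext (LinearMap.ext fun x => E.symm_apply_apply x),
    OS.Hom.ext (LinearMap.ext hE)⟩

theorem OS.HasRetractsT.isStrongGenerator {G : OS.{u}} (hG : G.HasRetractsT) :
    (ObjectProperty.singleton G).IsStrongGenerator := by
  rw [ObjectProperty.isStrongGenerator_iff]
  refine ⟨fun X Y f g h => hG.ext fun k => h G (by simp) k, fun X Y i _ h => hG.isIso i fun k => ?_⟩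
  exact h G (by simp) k

end generator

/-! ### Summands of an `ℓ¹` direct sum -/

section l1

variable {Λ : Type u} {X : Λ → Type v} [∀ l, NormedAddCommGroup (X l)] [∀ l, NormedSpace ℂ (X l)]
  (S : ∀ l, OSS (X l))

variable (X) in
/-- The coordinate projection `⨁¹ Xₗ → Xₗ`. -/
def l1Coord (l : Λ) : lp X 1 →ₗ[ℂ] X l where
  toFun a := a l
  map_add' _ _ := rfl
  map_smul' _ _ := rfl

variable (X) in
open Classical in
/-- The inclusion `Xₗ → ⨁¹ Xₗ`. -/
def l1Incl (l : Λ) : X l →ₗ[ℂ] lp X 1 where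
  toFun a := lp.single 1 l a
  map_add' a b := lp.single_add 1 l a b
  map_smul' c a := lp.single_smul 1 l c a

theorem l1Coord_l1Incl (l : Λ) (a : X l) : l1Coord X l (l1Incl X l a) = a := by
  classical
  exact lp.single_apply_self 1 l a

theorem l1Functional_l1Incl (l : Λ) (a : X l) (φ : lp (fun l => StrongDual ℂ (X l)) ∞) :
    l1Functional X (l1Incl X l a) φ = φ l a := by
  classical
  change ∑' l', φ l' ((lp.single 1 l a : lp X 1) l') = φ l a
  rw [tsum_eq_single l]
  · rw [lp.single_apply_self]
  · intro l' hl
    rw [lp.single_apply_ne 1 l a hl, map_zero]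

/-- The pairing of matrices over two spaces has the same norm from either side. -/
theorem norm_pairMatrix_swap {V W : Type*} [NormedAddCommGroup V] [NormedSpace ℂ V]
    [NormedAddCommGroup W] [NormedSpace ℂ W] {k m : ℕ} {φ : Matrix (Fin k) (Fin k) (StrongDual ℂ V)}
    {v : Matrix (Fin m) (Fin m) V} {ψ : Matrix (Fin m) (Fin m) (StrongDual ℂ W)}
    {w : Matrix (Fin k) (Fin k) W} (h : ∀ i j p q, φ i j (v p q) = ψ p q (w i j)) :
    ‖pairMatrix φ v‖ = ‖pairMatrix ψ w‖ := by
  rw [← norm_submatrix_equiv (Equiv.prodComm (Fin k) (Fin m))]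
  congr 1
  ext x y
  exact h _ _ _ _

theorem mnorm_map_l1Incl_le (l : Λ) {k : ℕ} (x : Matrix (Fin k) (Fin k) (X l)) :
    (OSS.l1 S).mnorm k (x.map (l1Incl X l)) ≤ (S l).mnorm k x := by
  refine dualNorm_le _ fun m φ hφ => ?_
  rw [norm_pairMatrix_swap (φ := (x.map (l1Incl X l)).map (l1Embed X))
    (ψ := φ.map (linfCoord (fun l => StrongDual ℂ (X l)) l)) (w := x)
    fun i j p q => l1Functional_l1Incl l (x i j) (φ p q)]
  have h1 : (S l).dualNorm m (φ.map (linfCoord (fun l => StrongDual ℂ (X l)) l)) ≤ 1 :=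
    (le_linfNorm (fun l => (S l).dual) φ l).trans hφ
  exact (norm_pairMatrix_le (S l) _ x).trans (mul_le_of_le_one_left ((S l).mnorm_nonneg x) h1)

/-- The coordinate projections are completely contractive. By Ruan's lemma, norms in `Mₖ(Xₗ)` are
computed by functionals on `Xₗ`, which extend by zero to elements of `⨁^∞ Xₗ*`. -/
theorem mnorm_map_l1Coord_le (l : Λ) {k : ℕ} (x : Matrix (Fin k) (Fin k) (lp X 1)) :
    (S l).mnorm k (x.map (l1Coord X l)) ≤ (OSS.l1 S).mnorm k x := by
  classical
  set C := (OSS.l1 S).mnorm k x with hC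
  have hC0 : 0 ≤ C := (OSS.l1 S).mnorm_nonneg x
  refine le_of_forall_pos_le_add fun δ hδ => ?_
  obtain ⟨ψ, hψ, hz⟩ := (S l).exists_norming_matrix (x.map (l1Coord X l))
    (show 0 < δ / (C + 1) by positivity)
  -- the functionals that are given by `ψ` on the summand `l` and vanish on the others
  let Φ : Matrix (Fin k) (Fin k) (lp (fun l => StrongDual ℂ (X l)) ∞) :=
    ψ.map fun f => lp.single ∞ l f
  have hΦ : linfNorm (fun l => (S l).dual) k Φ ≤ 1 := by
    refine linfNorm_le _ zero_le_one fun l' => ?_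
    rcases eq_or_ne l' l with rfl | hl
    · have e : Φ.map (linfCoord (fun l => StrongDual ℂ (X l)) l') = ψ := by
        ext i j : 1
        exact lp.single_apply_self (E := fun l => StrongDual ℂ (X l)) ∞ l' (ψ i j)
      rw [e]; exact hψ
    · have e : Φ.map (linfCoord (fun l => StrongDual ℂ (X l)) l') = 0 := by
        ext i j : 1
        exact lp.single_apply_ne (E := fun l => StrongDual ℂ (X l)) ∞ l (ψ i j) hl
      rw [e, OSS.mnorm_zero]; exact zero_le_one
  have h1 : ‖pairMatrix ψ (x.map (l1Coord X l))‖ ≤ C := by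
    have h2 : ‖pairMatrix (x.map (l1Embed X)) Φ‖ ≤ C :=
      le_dualNorm (OSS.linf fun l => (S l).dual) _ Φ hΦ
    rwa [norm_pairMatrix_swap (ψ := ψ) (w := x.map (l1Coord X l))] at h2
    intro i j p q
    change ∑' l', (lp.single ∞ l (ψ p q) : lp (fun l => StrongDual ℂ (X l)) ∞) l' (x i j l') =
      ψ p q (x i j l)
    rw [tsum_eq_single l]
    · rw [lp.single_apply_self]
    · intro l' hl
      rw [lp.single_apply_ne ∞ l _ hl, _root_.zero_apply]
  have h3 : δ / (C + 1) * C ≤ δ := by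
    rw [div_mul_eq_mul_div, div_le_iff₀ (by positivity)]; nlinarith
  calc _ ≤ (1 + δ / (C + 1)) * ‖pairMatrix ψ (x.map (l1Coord X l))‖ := hz
    _ ≤ (1 + δ / (C + 1)) * C := by gcongr
    _ ≤ _ := by linarith

end l1

theorem OS.l1SumT_hasRetractsT : OS.l1SumT.{u}.HasRetractsT := fun n =>
  ⟨⟨l1Incl (fun l : ULift.{u} ℕ => TMat l.down) ⟨n⟩, fun _ x =>
      mnorm_map_l1Incl_le (fun l : ULift.{u} ℕ => OSS.tMat l.down) ⟨n⟩ x⟩,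
    ⟨l1Coord (fun l : ULift.{u} ℕ => TMat l.down) ⟨n⟩, fun _ x =>
      mnorm_map_l1Coord_le (fun l : ULift.{u} ℕ => OSS.tMat l.down) ⟨n⟩ x⟩,
    fun a => l1Coord_l1Incl (X := fun l : ULift.{u} ℕ => TMat l.down) ⟨n⟩ a⟩

/-! ### Finite matrices as operators on a Hilbert space -/

section matrixOp

open Matrix

variable {H κ : Type*} [NormedAddCommGroup H] [InnerProductSpace ℂ H]

/-- The compression `[⟨g i, B g j⟩]` of an operator `B` on `H` to a family `g`. -/
def compress (g : κ → H) (B : H →L[ℂ] H) : Matrix κ κ ℂ :=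
  Matrix.of fun i j => inner ℂ (g i) (B (g j))

theorem compress_one [DecidableEq κ] {g : κ → H} (hg : Orthonormal ℂ g) : compress g (1 : H →L[ℂ] H) = 1 := by
  ext i j
  exact orthonormal_iff_ite.1 hg i j

variable [Fintype κ]

/-- The operator `∑ b i j |g i⟩⟨g j|` on `H`: for an orthonormal family `g`, the operator with matrix
`b` on the span of `g` that vanishes on its orthogonal complement. -/
def matrixOp (g : κ → H) : Matrix κ κ ℂ →ₗ[ℂ] (H →L[ℂ] H) where
  toFun b := ∑ i, ∑ j, b i j • InnerProductSpace.rankOne ℂ (g i) (g j)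
  map_add' b c := by simp only [Matrix.add_apply, add_smul, Finset.sum_add_distrib]
  map_smul' r b := by
    simp only [Matrix.smul_apply, smul_eq_mul, mul_smul, Finset.smul_sum, RingHom.id_apply]

theorem matrixOp_def (g : κ → H) (b : Matrix κ κ ℂ) :
    matrixOp g b = ∑ i, ∑ j, b i j • InnerProductSpace.rankOne ℂ (g i) (g j) := rfl

theorem matrixOp_apply (g : κ → H) (b : Matrix κ κ ℂ) (x : H) :
    matrixOp g b x = ∑ i, ∑ j, (b i j * inner ℂ (g j) x) • g i := by
  simp only [matrixOp_def, _root_.sum_apply, _root_.smul_apply,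
    InnerProductSpace.rankOne_apply, smul_smul]

theorem matrixOp_comp_matrixOp (g : κ → H) (b c : Matrix κ κ ℂ) (B : H →L[ℂ] H) :
    matrixOp g b * B * matrixOp g c = matrixOp g (b * compress g B * c) := by
  ext x
  rw [mul_apply_eq_comp, mul_apply_eq_comp, matrixOp_apply, matrixOp_apply, matrixOp_apply]
  simp only [map_sum, map_smul, inner_sum, inner_smul_right, ← Finset.sum_smul,
    Matrix.mul_apply, Finset.mul_sum, Finset.sum_mul, compress, Matrix.of_apply]
  refine Finset.sum_congr rfl fun i _ => ?_
  congr 1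
  calc _ = ∑ j, ∑ l, ∑ k, b i j * (c k l * inner ℂ (g l) x * inner ℂ (g j) (B (g k))) :=
        Finset.sum_congr rfl fun j _ => Finset.sum_comm
    _ = ∑ l, ∑ j, ∑ k, b i j * (c k l * inner ℂ (g l) x * inner ℂ (g j) (B (g k))) :=
        Finset.sum_comm
    _ = _ := by
        refine Finset.sum_congr rfl fun l _ => ?_
        rw [Finset.sum_comm]
        exact Finset.sum_congr rfl fun k _ => Finset.sum_congr rfl fun j _ => by ring

theorem compress_matrixOp [DecidableEq κ] {g : κ → H} (hg : Orthonormal ℂ g) (b : Matrix κ κ ℂ) :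
    compress g (matrixOp g b) = b := by
  ext i j
  simp only [compress, Matrix.of_apply, matrixOp_apply, inner_sum, inner_smul_right,
    orthonormal_iff_ite.1 hg]
  simp

theorem matrixOp_mul [DecidableEq κ] {g : κ → H} (hg : Orthonormal ℂ g) (b c : Matrix κ κ ℂ) :
    matrixOp g b * matrixOp g c = matrixOp g (b * c) := by
  have h := matrixOp_comp_matrixOp g b c 1
  rwa [compress_one hg, mul_one, mul_one] at h

variable [CompleteSpace H]

theorem star_matrixOp (g : κ → H) (b : Matrix κ κ ℂ) :
    star (matrixOp g b) = matrixOp g (star b) := by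
  simp only [matrixOp_def, star_sum, star_smul, ContinuousLinearMap.star_eq_adjoint,
    InnerProductSpace.adjoint_rankOne]
  rw [Finset.sum_comm]
  rfl

variable [DecidableEq κ]

/-- For an orthonormal family `g`, the map `matrixOp g` is completely isometric, being an injective
`*`-homomorphism. -/
theorem cstarNorm_matrixOp {g : κ → H} (hg : Orthonormal ℂ g) {m : ℕ}
    (b : Matrix (Fin m × κ) (Fin m × κ) ℂ) :
    cstarNorm (H →L[ℂ] H) m
      (Matrix.of fun p q => matrixOp g (Matrix.of fun i j => b (p, i) (q, j))) = ‖b‖ := by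
  let _ := CStarAlgebra.spectralOrder (H →L[ℂ] H)
  have _ := CStarAlgebra.spectralOrderedRing (H →L[ℂ] H)
  let f : Matrix (Fin m × κ) (Fin m × κ) ℂ →⋆ₙₐ[ℂ] CStarMatrix (Fin m) (Fin m) (H →L[ℂ] H) :=
    { toFun := fun b => CStarMatrix.ofMatrix
        (Matrix.of fun p q => matrixOp g (Matrix.of fun i j => b (p, i) (q, j)))
      map_smul' := fun c b => by
        ext p q : 1
        exact (matrixOp g).map_smul c _
      map_zero' := by
        ext p q : 1
        exact (matrixOp g).map_zero
      map_add' := fun b c => by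
        ext p q : 1
        exact (matrixOp g).map_add _ _
      map_mul' := fun b c => by
        ext p q : 1
        rw [CStarMatrix.mul_apply]
        simp only [CStarMatrix.ofMatrix_apply, Matrix.of_apply, matrixOp_mul hg, ← map_sum]
        congr 1
        ext i j
        simp [Matrix.mul_apply, Fintype.sum_prod_type, Matrix.sum_apply]
      map_star' := fun b => by
        ext p q : 1
        rw [CStarMatrix.star_apply]
        exact (star_matrixOp g (Matrix.of fun i j => b (q, i) (p, j))).symm }
  have hf : Function.Injective f := fun a b h => by
    ext ⟨p, i⟩ ⟨q, j⟩
    have h1 : matrixOp g (Matrix.of fun i j => a (p, i) (q, j)) =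
      matrixOp g (Matrix.of fun i j => b (p, i) (q, j)) := congrFun (congrFun h p) q
    have h2 := congrArg (compress g) h1
    rw [compress_matrixOp hg, compress_matrixOp hg] at h2
    exact congrFun (congrFun h2 i) j
  exact NonUnitalStarAlgHom.norm_map f hf b

/-- Compression to an orthonormal family is completely contractive: with the projection `P` onto
the span, `[P B P]` is the image of the compressed matrix under an isometric embedding. -/
theorem norm_compress_le {g : κ → H} (hg : Orthonormal ℂ g) {m : ℕ}
    (B : Matrix (Fin m) (Fin m) (H →L[ℂ] H)) :
    ‖(Matrix.of fun x y => compress g (B x.1 y.1) x.2 y.2 :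
      Matrix (Fin m × κ) (Fin m × κ) ℂ)‖ ≤ cstarNorm (H →L[ℂ] H) m B := by
  rw [← cstarNorm_matrixOp hg]
  -- the diagonal matrix with entries `P`
  let D : Matrix (Fin m) (Fin m) (H →L[ℂ] H) := Matrix.of fun p q =>
    matrixOp g (Matrix.of fun i j => (1 : Matrix (Fin m × κ) (Fin m × κ) ℂ) (p, i) (q, j))
  have hD : cstarNorm (H →L[ℂ] H) m D ≤ 1 := (cstarNorm_matrixOp hg 1).trans_le norm_one_le
  have hDv : ∀ p q, D p q = if p = q then matrixOp g 1 else 0 := by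
    intro p q
    simp only [D, Matrix.of_apply, Matrix.one_apply, Prod.mk.injEq]
    split_ifs with h
    · congr 1; ext i j; simp [h, Matrix.one_apply]
    · simp only [h, false_and, if_false]
      exact (matrixOp g).map_zero
  let _ := CStarAlgebra.spectralOrder (H →L[ℂ] H)
  have _ := CStarAlgebra.spectralOrderedRing (H →L[ℂ] H)
  have e : CStarMatrix.ofMatrix (Matrix.of fun p q => matrixOp g (Matrix.of fun i j =>
      compress g (B p q) i j)) =
      CStarMatrix.ofMatrix D * CStarMatrix.ofMatrix B * CStarMatrix.ofMatrix D := by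
    ext p q : 1
    simp only [CStarMatrix.mul_apply, CStarMatrix.ofMatrix_apply, Matrix.of_apply, hDv,
      ite_mul, mul_ite, zero_mul, mul_zero, Finset.sum_ite_eq, Finset.sum_ite_eq',
      Finset.mem_univ, if_true]
    rw [matrixOp_comp_matrixOp, one_mul, mul_one]
    rfl
  change ‖CStarMatrix.ofMatrix (Matrix.of fun p q => matrixOp g (Matrix.of fun i j =>
      compress g (B p q) i j))‖ ≤ ‖CStarMatrix.ofMatrix B‖
  have hD' : ‖CStarMatrix.ofMatrix D‖ ≤ 1 := hD
  rw [e]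
  calc _ ≤ ‖CStarMatrix.ofMatrix D‖ * ‖CStarMatrix.ofMatrix B‖ * ‖CStarMatrix.ofMatrix D‖ :=
        (norm_mul_le _ _).trans (by gcongr; exact norm_mul_le _ _)
    _ ≤ 1 * ‖CStarMatrix.ofMatrix B‖ * 1 := by gcongr
    _ = _ := by ring

theorem norm_blockDiagonal'_le {Λ : Type*} [Fintype Λ] [DecidableEq Λ] {ι : Λ → Type*}
    [∀ l, Fintype (ι l)] [∀ l, DecidableEq (ι l)] (b : ∀ l, Matrix (ι l) (ι l) ℂ) {C : ℝ}
    (hC : 0 ≤ C) (h : ∀ l, ‖b l‖ ≤ C) : ‖Matrix.blockDiagonal' b‖ ≤ C := by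
  let f : (∀ l, Matrix (ι l) (ι l) ℂ) →⋆ₙₐ[ℂ] Matrix (Σ l, ι l) (Σ l, ι l) ℂ :=
    { toFun := Matrix.blockDiagonal'
      map_smul' := fun c b => Matrix.blockDiagonal'_smul c b
      map_zero' := Matrix.blockDiagonal'_zero
      map_add' := fun b c => Matrix.blockDiagonal'_add b c
      map_mul' := fun b c => Matrix.blockDiagonal'_mul b c
      map_star' := fun b => (Matrix.blockDiagonal'_conjTranspose b).symm }
  exact (NonUnitalStarAlgHom.norm_apply_le f b).trans ((pi_norm_le_iff_of_nonneg hC).2 h)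

end matrixOp

/-! ### Block diagonals of trace class operators -/

section blocks

open Matrix

variable {ι H : Type*} [NormedAddCommGroup H] [InnerProductSpace ℂ H] [CompleteSpace H]
  {e : HilbertBasis ι ℂ H}

/-- The matrix of `T` in a family `g`, as an element of `Tₙ`. The transposition is the one that
makes the bilinear pairing of `Tₙ` with `Mₙ` the restriction of `⟨B, T⟩ = tr (B T)`. -/
def traceBlock (e : HilbertBasis ι ℂ H) {n : ℕ} (g : Fin n → H) : TraceClass e →ₗ[ℂ] TMat n where
  toFun T := (Matrix.of fun i j => inner ℂ (g j) (TraceClass.toOp e T (g i)) :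
    Matrix (Fin n) (Fin n) ℂ)
  map_add' S T := by
    refine Matrix.ext (m := Fin n) (n := Fin n) fun i j => ?_
    change inner ℂ (g j) (TraceClass.toOp e (S + T) (g i)) =
      inner ℂ (g j) (TraceClass.toOp e S (g i)) + inner ℂ (g j) (TraceClass.toOp e T (g i))
    rw [map_add, _root_.add_apply, inner_add_right]
  map_smul' c T := by
    refine Matrix.ext (m := Fin n) (n := Fin n) fun i j => ?_
    change inner ℂ (g j) (TraceClass.toOp e (c • T) (g i)) =
      c * inner ℂ (g j) (TraceClass.toOp e T (g i))
    rw [map_smul, _root_.smul_apply, inner_smul_right]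

theorem functional_matrixOp {κ : Type*} [Fintype κ] (T : TraceClass e) (g : κ → H)
    (b : Matrix κ κ ℂ) : TraceClass.functional e T (matrixOp g b) =
      ∑ i, ∑ j, b i j * inner ℂ (g j) (TraceClass.toOp e T (g i)) := by
  simp only [matrixOp_def, map_sum, map_smul, TraceClass.functional_rankOne, smul_eq_mul]

theorem toDual_traceBlock {n : ℕ} (g : Fin n → H) (T : TraceClass e)
    (b : Matrix (Fin n) (Fin n) ℂ) :
    TMat.toDual n (traceBlock e g T) b = TraceClass.functional e T (matrixOp g b) := by
  rw [functional_matrixOp, TMat.toDual_apply]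
  exact Finset.sum_congr rfl fun i _ => Finset.sum_congr rfl fun j _ =>
    mul_comm (inner ℂ (g j) (TraceClass.toOp e T (g i))) (b i j)

/-- The rank one operator `z ↦ ⟨x, z⟩ y`, as a trace class operator. -/
def TraceClass.rankOne (e : HilbertBasis ι ℂ H) (y x : H) : TraceClass e :=
  ⟨InnerProductSpace.rankOne ℂ y x, isTraceClass_of_summable fun B => by
    have h := e.summable_inner_mul_inner x (B y)
    refine h.congr fun i => ?_
    rw [InnerProductSpace.rankOne_apply, map_smul, inner_smul_right]⟩

theorem TraceClass.functional_of_rankOne (y x : H) (B : H →L[ℂ] H) :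
    TraceClass.functional e (TraceClass.rankOne e y x) B = inner ℂ x (B y) := by
  rw [TraceClass.functional_apply, opTrace, ← e.tsum_inner_mul_inner]
  refine tsum_congr fun i => ?_
  rw [mul_apply_eq_comp]
  change inner ℂ (e i) (B (InnerProductSpace.rankOne ℂ y x (e i))) = _
  rw [InnerProductSpace.rankOne_apply, map_smul, inner_smul_right]

/-- The embedding of `Tₙ` in `T(H)` given by a family `g`. -/
def blockIncl (e : HilbertBasis ι ℂ H) {n : ℕ} (g : Fin n → H) : TMat n →ₗ[ℂ] TraceClass e :=
  TMat.lift (Matrix.of fun i j => TraceClass.rankOne e (g j) (g i))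

theorem functional_blockIncl {n : ℕ} (g : Fin n → H) (a : TMat n) (B : H →L[ℂ] H) :
    TraceClass.functional e (blockIncl e g a) B = TMat.toDual n a (compress g B) := by
  rw [blockIncl, TMat.lift_apply, TMat.toDual_apply]
  simp only [map_sum, map_smul, _root_.sum_apply, _root_.smul_apply, Matrix.of_apply,
    TraceClass.functional_of_rankOne, compress, smul_eq_mul]

theorem norm_compress_one_le {n : ℕ} {g : Fin n → H} (hg : Orthonormal ℂ g) (B : H →L[ℂ] H) :
    ‖compress g B‖ ≤ ‖B‖ := by
  have h := norm_compress_le hg (fun _ _ => B : Matrix (Fin 1) (Fin 1) (H →L[ℂ] H))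
  rw [cstar_one, ← norm_submatrix_equiv (Equiv.uniqueProd (Fin n) (Fin 1)).symm] at h
  exact h

theorem norm_blockIncl_le {n : ℕ} {g : Fin n → H} (hg : Orthonormal ℂ g) (a : TMat n) :
    ‖blockIncl e g a‖ ≤ ‖a‖ := by
  rw [TraceClass.norm_def, ← TraceClass.norm_functional]
  refine ContinuousLinearMap.opNorm_le_bound _ (norm_nonneg a) fun B => ?_
  rw [functional_blockIncl]
  exact ((TMat.toDual n a).le_opNorm _).trans
    (mul_le_mul_of_nonneg_left (norm_compress_one_le hg B) (norm_nonneg a))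

/-- Evaluation at `b ∈ Mₙ`, as a functional on `Tₙ`. -/
def TMat.eval {n : ℕ} (b : Matrix (Fin n) (Fin n) ℂ) : StrongDual ℂ (TMat n) :=
  LinearMap.mkContinuous
    { toFun := fun a => TMat.toDual n a b
      map_add' := fun a a' => by rw [map_add]; rfl
      map_smul' := fun c a => by rw [map_smul]; rfl } ‖b‖ fun a => by
      rw [mul_comm]; exact (TMat.toDual n a).le_opNorm b

theorem TMat.norm_eval_le {n : ℕ} (b : Matrix (Fin n) (Fin n) ℂ) : ‖TMat.eval b‖ ≤ ‖b‖ :=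
  LinearMap.mkContinuous_norm_le _ (norm_nonneg b) _

variable {Λ : Type u} {n : Λ → ℕ}

theorem summable_blockIncl {f : ∀ l, Fin (n l) → H} (hf : ∀ l, Orthonormal ℂ (f l))
    (x : lp (fun l => TMat (n l)) 1) : Summable fun l => blockIncl e (f l) (x l) :=
  Summable.of_norm_bounded (hasSum_norm_l1 (fun l => TMat (n l)) x).summable
    fun l => norm_blockIncl_le (hf l) (x l)

/-- The block diagonal embedding `⨁¹ Tₙ → T(H)` given by orthonormal families `f l`. -/
def blocksIncl (e : HilbertBasis ι ℂ H) {f : ∀ l, Fin (n l) → H} (hf : ∀ l, Orthonormal ℂ (f l)) :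
    lp (fun l => TMat (n l)) 1 →ₗ[ℂ] TraceClass e where
  toFun x := ∑' l, blockIncl e (f l) (x l)
  map_add' x y := by
    rw [← (summable_blockIncl hf x).tsum_add (summable_blockIncl hf y)]
    exact tsum_congr fun l => map_add (blockIncl e (f l)) _ _
  map_smul' c x := by
    rw [RingHom.id_apply, ← (summable_blockIncl hf x).tsum_const_smul]
    exact tsum_congr fun l => map_smul (blockIncl e (f l)) _ _

theorem functional_blocksIncl {f : ∀ l, Fin (n l) → H} (hf : ∀ l, Orthonormal ℂ (f l))
    (x : lp (fun l => TMat (n l)) 1) (B : H →L[ℂ] H) :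
    TraceClass.functional e (blocksIncl e hf x) B =
      ∑' l, TMat.toDual (n l) (x l) (compress (f l) B) := by
  let E : TraceClass e →L[ℂ] ℂ :=
    (ContinuousLinearMap.apply ℂ ℂ B).comp (TraceClass.embed e).toContinuousLinearMap
  have h : E (∑' l, blockIncl e (f l) (x l)) = ∑' l, E (blockIncl e (f l) (x l)) :=
    E.map_tsum (summable_blockIncl hf x)
  exact h.trans (tsum_congr fun l => functional_blockIncl (f l) (x l) B)

/-- The block diagonal embedding is completely contractive, since it is dual to the compression of
operators to their diagonal blocks. -/
theorem mnorm_map_blocksIncl_le {f : ∀ l, Fin (n l) → H} (hf : ∀ l, Orthonormal ℂ (f l)) {k : ℕ}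
    (x : Matrix (Fin k) (Fin k) (lp (fun l => TMat (n l)) 1)) :
    (OSS.traceClass e).mnorm k (x.map (blocksIncl e hf)) ≤
      (OSS.l1 fun l => OSS.tMat (n l)).mnorm k x := by
  refine dualNorm_le _ fun m B hB => ?_
  have hB' : cstarNorm (H →L[ℂ] H) m B ≤ 1 := hB
  let Φ : Matrix (Fin m) (Fin m) (lp (fun l => StrongDual ℂ (TMat (n l))) ∞) :=
    Matrix.of fun p q => ⟨fun l => TMat.eval (compress (f l) (B p q)), memℓp_infty ⟨‖B p q‖, by
      rintro _ ⟨l, rfl⟩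
      exact (TMat.norm_eval_le _).trans (norm_compress_one_le (hf l) (B p q))⟩⟩
  have hΦ : linfNorm (fun l => (OSS.tMat (n l)).dual) m Φ ≤ 1 := by
    refine linfNorm_le _ zero_le_one fun l => dualNorm_le _ fun r w hw => ?_
    let c : Matrix (Fin m) (Fin m) (Matrix (Fin (n l)) (Fin (n l)) ℂ) :=
      Matrix.of fun p q => compress (f l) (B p q)
    have hc : cstarNorm (Matrix (Fin (n l)) (Fin (n l)) ℂ) m c ≤ 1 := by
      rw [cstarNorm_matrix]
      exact (norm_compress_le (hf l) B).trans hB'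
    rw [norm_pairMatrix_swap (ψ := w.map (TMat.toDual (n l))) (w := c) fun i j p q => rfl]
    refine (le_dualNorm (OSS.cstar (Matrix (Fin (n l)) (Fin (n l)) ℂ)) _ c hc).trans hw
  refine le_trans (le_of_eq ?_)
    (le_dualNorm (OSS.linf fun l => (OSS.tMat (n l)).dual) (x.map (l1Embed _)) Φ hΦ)
  congr 1
  ext y z
  exact functional_blocksIncl hf (x y.2 z.2) (B y.1 z.1)

/-- The pairing of finitely many diagonal blocks of `T ∈ Mₖ(T(H))` with functionals in the unit
balls of `Mₘ(Tₗ*)`: it is the pairing of `T` with a block diagonal operator matrix in the unit ball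
of `Mₘ(B(H))`. -/
theorem norm_sum_traceBlock_le {f : ∀ l, Fin (n l) → H}
    (hf : Orthonormal ℂ fun x : Σ l, Fin (n l) => f x.1 x.2) (F : Finset Λ) {k m : ℕ}
    (T : Matrix (Fin k) (Fin k) (TraceClass e))
    (φ : ∀ l, Matrix (Fin m) (Fin m) (StrongDual ℂ (TMat (n l))))
    (hφ : ∀ l, (OSS.tMat (n l)).dualNorm m (φ l) ≤ 1) :
    ‖(Matrix.of fun x y => ∑ l ∈ F, φ l x.1 y.1 (traceBlock e (f l) (T x.2 y.2)) :
      Matrix (Fin m × Fin k) (Fin m × Fin k) ℂ)‖ ≤ (OSS.traceClass e).mnorm k T := by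
  classical
  -- the matrix over `Mₙ` that represents `φ l`
  let b : ∀ l : F, Matrix (Fin m × Fin (n l)) (Fin m × Fin (n l)) ℂ := fun l =>
    Matrix.of fun x y => φ l x.1 y.1 (TMat.universal (n l) x.2 y.2)
  have hb : ∀ l, ‖b l‖ ≤ 1 := by
    intro l
    rw [← norm_submatrix_equiv (Equiv.prodComm (Fin (n l)) (Fin m))]
    exact (norm_pairMatrix_le (OSS.tMat (n l)) (φ l) (TMat.universal (n l))).trans
      (mul_le_one₀ (hφ l) ((OSS.tMat (n l)).mnorm_nonneg _) (TMat.mnorm_universal_le (n l)))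
  let g : (Σ l : F, Fin (n l)) → H := fun x => f x.1 x.2
  have hg : Orthonormal ℂ g := by
    refine hf.comp (fun x : Σ l : F, Fin (n l) => (⟨x.1.1, x.2⟩ : Σ l, Fin (n l))) ?_
    rintro ⟨⟨l, hl⟩, i⟩ ⟨⟨l', hl'⟩, j⟩ h
    simp only [Sigma.mk.injEq] at h
    obtain ⟨rfl, h⟩ := h
    rw [eq_of_heq h]
  let σ : Fin m × (Σ l : F, Fin (n l)) ≃ Σ l : F, Fin m × Fin (n l) :=
    { toFun := fun x => ⟨x.2.1, x.1, x.2.2⟩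
      invFun := fun x => (x.2.1, ⟨x.1, x.2.2⟩)
      left_inv := fun _ => rfl
      right_inv := fun _ => rfl }
  let β : Matrix (Fin m × Σ l : F, Fin (n l)) (Fin m × Σ l : F, Fin (n l)) ℂ :=
    (Matrix.blockDiagonal' b).submatrix σ σ
  have hβ : ‖β‖ ≤ 1 := by
    rw [norm_submatrix_equiv]
    exact norm_blockDiagonal'_le b zero_le_one hb
  let B : Matrix (Fin m) (Fin m) (H →L[ℂ] H) :=
    Matrix.of fun p q => matrixOp g (Matrix.of fun i j => β (p, i) (q, j))
  have hB : cstarNorm (H →L[ℂ] H) m B ≤ 1 := (cstarNorm_matrixOp hg β).trans_le hβ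
  refine le_trans (le_of_eq ?_) (le_dualNorm (OSS.cstar (H →L[ℂ] H)) (T.map (TraceClass.embed e))
    B hB)
  congr 1
  ext ⟨p, i⟩ ⟨q, j⟩
  change ∑ l ∈ F, φ l p q (traceBlock e (f l) (T i j)) = TraceClass.functional e (T i j) (B p q)
  rw [show B p q = matrixOp g (Matrix.of fun i j => β (p, i) (q, j)) from rfl,
    functional_matrixOp, Fintype.sum_sigma, ← Finset.sum_coe_sort]
  refine Finset.sum_congr rfl fun l _ => ?_
  have h1 := TMat.apply_eq_sum (φ l p q).toLinearMap (traceBlock e (f l) (T i j))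
  refine h1.trans (Finset.sum_congr rfl fun s _ => ?_)
  rw [Fintype.sum_sigma, Finset.sum_eq_single l]
  · refine Finset.sum_congr rfl fun t _ => ?_
    have h2 : β (p, ⟨l, s⟩) (q, ⟨l, t⟩) = φ l p q (TMat.universal (n l) s t) :=
      Matrix.blockDiagonal'_apply_eq b l (p, s) (q, t)
    rw [Matrix.of_apply, h2, mul_comm]
    rfl
  · intro l' _ hl
    refine Finset.sum_eq_zero fun t _ => ?_
    have h2 : β (p, ⟨l, s⟩) (q, ⟨l', t⟩) = 0 :=
      Matrix.blockDiagonal'_apply_ne b (p, s) (q, t) (Ne.symm hl)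
    rw [Matrix.of_apply, h2, zero_mul]
  · simp

/-- The diagonal blocks are absolutely summable: this is the scalar case of
`norm_sum_traceBlock_le`, for functionals that norm the blocks. -/
theorem sum_norm_traceBlock_le {f : ∀ l, Fin (n l) → H}
    (hf : Orthonormal ℂ fun x : Σ l, Fin (n l) => f x.1 x.2) (F : Finset Λ) (T : TraceClass e) :
    ∑ l ∈ F, ‖traceBlock e (f l) T‖ ≤ ‖T‖ := by
  choose φ hφ hφT using fun l => exists_dual_vector'' ℂ (traceBlock e (f l) T)
  have h := norm_sum_traceBlock_le hf F (fun _ _ => T : Matrix (Fin 1) (Fin 1) (TraceClass e))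
    (fun l => (fun _ _ => φ l : Matrix (Fin 1) (Fin 1) (StrongDual ℂ (TMat (n l)))))
    (fun l => (dualNorm_one (OSS.tMat (n l)) (φ l)).trans_le (hφ l))
  rw [(OSS.traceClass e).mnorm_one] at h
  refine le_trans (le_of_eq ?_) h
  have e1 : (Matrix.of fun x y => ∑ l ∈ F, φ l (traceBlock e (f l) T) :
      Matrix (Fin 1 × Fin 1) (Fin 1 × Fin 1) ℂ) =
      Matrix.diagonal fun _ => ((∑ l ∈ F, ‖traceBlock e (f l) T‖ : ℝ) : ℂ) := by
    ext x y
    rw [Subsingleton.elim x y, Matrix.diagonal_apply_eq, Matrix.of_apply]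
    push_cast
    exact Finset.sum_congr rfl fun l _ => hφT l
  refine Eq.trans ?_ (congrArg norm e1).symm
  rw [Matrix.l2_opNorm_diagonal, Pi.norm_def]
  simp only [Finset.sup_const, Finset.univ_nonempty, coe_nnnorm, Complex.norm_real]
  rw [Real.norm_of_nonneg (by positivity)]

/-- The compression `T(H) → ⨁¹ Tₙ` to the diagonal blocks given by an orthonormal family. -/
def traceBlocks (e : HilbertBasis ι ℂ H) {f : ∀ l, Fin (n l) → H}
    (hf : Orthonormal ℂ fun x : Σ l, Fin (n l) => f x.1 x.2) :
    TraceClass e →ₗ[ℂ] lp (fun l => TMat (n l)) 1 where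
  toFun T := ⟨fun l => traceBlock e (f l) T, memℓp_gen' (C := ‖T‖) fun F => by
    simpa using sum_norm_traceBlock_le hf F T⟩
  map_add' S T := by
    ext l : 2
    exact map_add (traceBlock e (f l)) S T
  map_smul' c T := by
    ext l : 2
    exact map_smul (traceBlock e (f l)) c T

/-- Taking diagonal blocks is completely contractive. The pairing with elements of `⨁^∞ Tₗ*` is a
limit of pairings of finitely many blocks. -/
theorem mnorm_map_traceBlocks_le {f : ∀ l, Fin (n l) → H}
    (hf : Orthonormal ℂ fun x : Σ l, Fin (n l) => f x.1 x.2) {k : ℕ}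
    (T : Matrix (Fin k) (Fin k) (TraceClass e)) :
    (OSS.l1 fun l => OSS.tMat (n l)).mnorm k (T.map (traceBlocks e hf)) ≤
      (OSS.traceClass e).mnorm k T := by
  refine dualNorm_le _ fun m Φ hΦ => ?_
  have hφ : ∀ l, (OSS.tMat (n l)).dualNorm m
      (Φ.map (linfCoord (fun l => StrongDual ℂ (TMat (n l))) l)) ≤ 1 := fun l =>
    (le_linfNorm (fun l => (OSS.tMat (n l)).dual) Φ l).trans hΦ
  let A : Matrix (Fin m × Fin k) (Fin m × Fin k) ℂ :=
    pairMatrix ((T.map (traceBlocks e hf)).map (l1Embed fun l => TMat (n l))) Φ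
  let A' : Finset Λ → Matrix (Fin m × Fin k) (Fin m × Fin k) ℂ := fun F => Matrix.of fun x y =>
    ∑ l ∈ F, Φ x.1 y.1 l (traceBlock e (f l) (T x.2 y.2))
  have hlim : Filter.Tendsto A' Filter.atTop (nhds A) := by
    refine tendsto_pi_nhds.2 fun x => tendsto_pi_nhds.2 fun y => ?_
    have hs := summable_l1 (fun l => TMat (n l)) (traceBlocks e hf (T x.2 y.2)) (Φ x.1 y.1)
    exact hs.hasSum
  have hA' : ∀ F, ‖A' F‖ ≤ (OSS.traceClass e).mnorm k T := fun F =>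
    norm_sum_traceBlock_le hf F T
      (fun l => Φ.map (linfCoord (fun l => StrongDual ℂ (TMat (n l))) l)) hφ
  have hA : ‖A‖ ≤ (OSS.traceClass e).mnorm k T :=
    le_of_tendsto hlim.norm (Filter.Eventually.of_forall hA')
  exact hA

theorem traceBlocks_blocksIncl {f : ∀ l, Fin (n l) → H}
    (hf : Orthonormal ℂ fun x : Σ l, Fin (n l) => f x.1 x.2) (hf' : ∀ l, Orthonormal ℂ (f l))
    (x : lp (fun l => TMat (n l)) 1) : traceBlocks e hf (blocksIncl e hf' x) = x := by
  ext l : 2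
  apply (TMat.toDual_bijective (n l)).1
  ext b
  refine (toDual_traceBlock (f l) (blocksIncl e hf' x) b).trans ?_
  rw [functional_blocksIncl, tsum_eq_single l, compress_matrixOp (hf' l)]
  intro l' hl
  have h : compress (f l') (matrixOp (f l) b) = 0 := by
    ext i j
    have h0 : ∀ s, inner ℂ (f l' i) (f l s) = 0 := fun s =>
      hf.2 (i := ⟨l', i⟩) (j := ⟨l, s⟩) fun h => hl (congrArg Sigma.fst h)
    simp [compress, matrixOp_apply, h0]
  rw [h, map_zero]

end blocks

/-- A partition of part of the standard basis of `ℓ₂` into blocks of all sizes. -/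
theorem exists_orthonormal_blocks : ∃ f : ∀ l : ULift.{u} ℕ,
    Fin l.down → lp (fun _ : ULift.{u} ℕ => ℂ) 2,
    Orthonormal ℂ fun x : Σ l : ULift.{u} ℕ, Fin l.down => f x.1 x.2 := by
  obtain ⟨σ, hσ⟩ := exists_injective_nat (Σ l : ULift.{u} ℕ, Fin l.down)
  exact ⟨fun l i => l2Basis (ULift.up (σ ⟨l, i⟩)),
    l2Basis.orthonormal.comp _ (ULift.up_injective.comp hσ)⟩

/-- `⨁¹ Tₙ` is a completely contractive retract of `T(ℓ₂)`. -/
theorem OS.exists_retraction : ∃ (q : OS.traceClassL2.{u} ⟶ OS.l1SumT.{u})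
    (s : OS.l1SumT.{u} ⟶ OS.traceClassL2.{u}), ∀ x, q.toLinearMap (s.toLinearMap x) = x := by
  obtain ⟨f, hf⟩ := exists_orthonormal_blocks.{u}
  have hf' : ∀ l, Orthonormal ℂ (f l) := fun l =>
    hf.comp (fun i => ⟨l, i⟩) fun i j h => eq_of_heq (Sigma.mk.inj h).2
  exact ⟨⟨traceBlocks l2Basis hf, fun _ T => mnorm_map_traceBlocks_le hf T⟩,
    ⟨blocksIncl l2Basis hf', fun _ x => mnorm_map_blocksIncl_le hf' x⟩,
    traceBlocks_blocksIncl hf hf'⟩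

theorem OS.isCompleteQuotient_of_retraction {X Y : OS.{u}} (q : X ⟶ Y) (s : Y ⟶ X)
    (h : ∀ y, q.toLinearMap (s.toLinearMap y) = y) : OS.IsCompleteQuotient q.toLinearMap := by
  intro n
  ext y
  constructor
  · rintro ⟨x, hx, rfl⟩
    exact (q.mnorm_map_le n x).trans_lt hx
  · intro hy
    refine ⟨y.map s.toLinearMap, (s.mnorm_map_le n y).trans_lt hy, ?_⟩
    ext i j
    exact h (y i j)

end OpSp

end

theorem mainTheorem6 :
    (CategoryTheory.ObjectProperty.singleton OpSp.OS.traceClassL2.{u}).IsStrongGenerator ∧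
    (CategoryTheory.ObjectProperty.singleton OpSp.OS.l1SumT.{u}).IsStrongGenerator ∧
    ∃ q : OpSp.OS.traceClassL2.{u} ⟶ OpSp.OS.l1SumT.{u},
      OpSp.OS.IsCompleteQuotient q.toLinearMap := by
  obtain ⟨q, s, hqs⟩ := OpSp.OS.exists_retraction.{u}
  refine ⟨OpSp.OS.HasRetractsT.isStrongGenerator fun n => ?_,
    OpSp.OS.l1SumT_hasRetractsT.isStrongGenerator,
    q, OpSp.OS.isCompleteQuotient_of_retraction q s hqs⟩
  obtain ⟨i, p, hip⟩ := OpSp.OS.l1SumT_hasRetractsT.{u} n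
  refine ⟨i.trans s, OpSp.OS.Hom.trans q p, fun a => ?_⟩
  rw [OpSp.OS.Hom.trans_apply, OpSp.OS.Hom.trans_apply, hqs, hip]
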